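/- Fix $\kappa\in\{1/2,\pi\}$, the normalization of the Gaussian weight $\rho_\Sigma(x)=\exp(-\kappa\,x^\top\Sigma^{-1}x)$. For an invertible $S\in\mathbb R^{n\times n}$ with $\Sigma=S^\top S$, let $\mathcal D_{\mathbb Z^n,S}$ be the probability distribution on $\mathbb Z^n$ with mass proportional to $\rho_\Sigma$, and let $\mathcal N_\kappa(\Sigma)$ be the Gaussian distribution on $\mathbb R^n$ with density proportional to $\rho_\Sigma$, i.e. $\mathcal N(0,\Sigma/(2\kappa))$; so $\mathcal N_{1/2}(\Sigma)=\mathcal N(0,\Sigma)$. Let $\sigma_1(S)\ge\dots\ge\sigma_n(S)$ be the singular values of $S$. Preprocessing. Let $A_0\in\mathbb Z^{r\times n}$ have entries bounded in absolute value by $Q$. Call $\widetilde A\in\mathbb Z^{\ell\times n}$ a preprocessing of $A_0$ if $\ell\le 4r$, the rows of $\widetilde A$ are linearly independent, the real row span of $\widetilde A$ contains that of $A_0$, and the lattice $\{x\in\mathbb Z^n:\widetilde Ax=0\}$ contains $n-\ell$ linearly independent vectors of Euclidean norm at most $Q\sqrt n$ (i.e. its successive minima are all at most $Q\sqrt n$).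 Theorem. There is an absolute constant $Q_0$ such that the following holds for all $n$, $r\le n/4$, $\delta\in(0,1/10)$, real $Q\ge\max\{2,Q_0,(2n/\delta)^{30}\}$, and $A_0\in\mathbb Z^{r\times n}$ with entries bounded in absolute value by $Q$. (a) $A_0$ has a preprocessing. (b) Let $\widetilde A\in\mathbb Z^{\ell\times n}$ be any preprocessing of $A_0$, and let $A\in\mathbb R^{\ell\times n}$ be any matrix with orthonormal rows and the same row span as $\widetilde A$. Let $\mathcal M$ be a finite set and $B$ an $\mathcal M$-valued random variable. For each $b\in\mathcal M$ let $\mathcal I_b$ be a probability distribution on $\mathbb Z^n$ and let $S_b\in\mathbb R^{n\times n}$ be such that $\Sigma_b=S_b^\top S_b$ has full rank and $$Q^{6/5}\ge\sigma_1(S_b)\ge\sigma_n(S_b)\ge nQ\log Q .$$ Suppose that, conditioned on $B=b$, the random variables $X\sim\mathcal D_{\mathbb Z^n,S_b}$, $G\sim\mathcal N_\kappa(\Sigma_b)$ and $Y\sim\mathcal I_b$ are mutually independent. (Here and below, statements conditioned on $B=b$ are for the $b$ with $\Pr[B=b]>0$.) Let $f:\mathbb R^n\to\mathcal M\cup\{\perp\}$,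 and let $g:\mathbb Z^\ell\to\mathcal M\cup\{\perp\}$ be such that for every $b\in\mathcal M$ $$\Pr\bigl[g(\widetilde A(X+Y))=f(X+Y)\mid B=b\bigr]\ge 1-\delta/3 .$$ Then there is a measurable $h:\mathbb R^\ell\to\mathcal M$ such that - for every $b\in\mathcal M$ with $\Pr[f(X+Y)=b\mid B=b]\ge1-\delta/3$, we have $\Pr[h(A(G+Y))=b\mid B=b]\ge1-\delta$ (in particular, if the former holds for every $b$, so does the latter); - if $\Pr[f(X+Y)=B]\ge1-\delta/3$, then $\Pr[h(A(G+Y))=B]\ge1-\delta$. -/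

import Mathlib

open MeasureTheory ProbabilityTheory Matrix

noncomputable section

namespace LinearSketch

/-- An integer vector, viewed as a point of Euclidean space `ℝⁿ`. -/
def intVec {n : ℕ} (x : Fin n → ℤ) : EuclideanSpace ℝ (Fin n) :=
  WithLp.toLp 2 fun i => (x i : ℝ)

/-- The action `x ↦ A x` of a real matrix on Euclidean space. -/
def sketch {m n : ℕ} (A : Matrix (Fin m) (Fin n) ℝ) (x : EuclideanSpace ℝ (Fin n)) :
    EuclideanSpace ℝ (Fin m) :=
  Matrix.toEuclideanLin A x

/-- An integer matrix, viewed as a real matrix. -/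
def toReal {m n : ℕ} (A : Matrix (Fin m) (Fin n) ℤ) : Matrix (Fin m) (Fin n) ℝ :=
  A.map fun z => (z : ℝ)

/-- The row span of a real matrix, as a subspace of `ℝⁿ`. -/
def rowSpan {m n : ℕ} (A : Matrix (Fin m) (Fin n) ℝ) : Submodule ℝ (Fin n → ℝ) :=
  Submodule.span ℝ (Set.range A.row)

/-- The `i`-th largest singular value `σ_{i+1}` (indices start at zero) of a real square matrix. -/
def singularValue {n : ℕ} (S : Matrix (Fin n) (Fin n) ℝ) (i : ℕ) : ℝ :=
  (Matrix.toEuclideanLin S).singularValues i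

/-- The unnormalized Gaussian weight `exp (-κ xᵀ Σ⁻¹ x)` at an integer point `x`. -/
def gaussianWeight {n : ℕ} (κ : ℝ) (Sig : Matrix (Fin n) (Fin n) ℝ) (x : Fin n → ℤ) : ℝ :=
  Real.exp (-κ * ((fun i => (x i : ℝ)) ⬝ᵥ (Sig⁻¹ *ᵥ fun i => (x i : ℝ))))

/-- The discrete Gaussian on `ℤⁿ`: the mass of `x` is proportional to `exp (-κ xᵀ Σ⁻¹ x)`. -/
def discreteGaussian {n : ℕ} (κ : ℝ) (Sig : Matrix (Fin n) (Fin n) ℝ) : Measure (Fin n → ℤ) :=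
  (∑' y : Fin n → ℤ, ENNReal.ofReal (gaussianWeight κ Sig y))⁻¹ •
    Measure.count.withDensity fun x => ENNReal.ofReal (gaussianWeight κ Sig x)

/-- The continuous Gaussian on `ℝⁿ` with density proportional to `exp (-κ xᵀ Σ⁻¹ x)`,
that is, `N(0, Σ / (2κ))`. -/
def continuousGaussian {n : ℕ} (κ : ℝ) (Sig : Matrix (Fin n) (Fin n) ℝ) :
    Measure (EuclideanSpace ℝ (Fin n)) :=
  multivariateGaussian 0 ((2 * κ)⁻¹ • Sig)

/-- `At` is a result of preprocessing the integer sketch `A₀`, whose entries are at most `Q`: it has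
at most four times as many rows, they are linearly independent, its row span contains that of `A₀`
(so that `At x` determines `A₀ x`), and all successive minima of the orthogonal lattice
`{x ∈ ℤⁿ | At x = 0}`, which has rank `n - ℓ`, are at most `Q √n`. -/
structure IsPreprocessed {r l n : ℕ} (Q : ℝ) (A₀ : Matrix (Fin r) (Fin n) ℤ)
    (At : Matrix (Fin l) (Fin n) ℤ) : Prop where
  rows_le : l ≤ 4 * r
  full_row_rank : LinearIndependent ℝ (toReal At).row
  rowSpan_le : rowSpan (toReal A₀) ≤ rowSpan (toReal At)
  minima_le : ∃ v : Fin (n - l) → Fin n → ℤ,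
    LinearIndependent ℤ v ∧ ∀ i, At *ᵥ v i = 0 ∧ ‖intVec (v i)‖ ≤ Q * √n

/-- `A` has orthonormal rows. -/
def RowOrthonormal {m n : ℕ} (A : Matrix (Fin m) (Fin n) ℝ) : Prop :=
  A * Aᵀ = 1

end LinearSketch

end

/-! The decoder is `h w = g (At *ᵥ ζ w)`, with a default label when `g` returns `none`. Here `ζ`
rounds a point of `ℝˡ` to an integer vector whose sketch under `A` is within `√n`, and it is
equivariant modulo `ker A` under translation by the lattice `A ℤⁿ` (`exists_measurable_rounding`).
Since `A` and `At` have the same row span, `At *ᵥ z` is a function of `A z`, so for integer `y`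
equivariance gives `At ζ(A(x + y)) = At y + At ζ(A x)`. The noise `Y` can therefore be fixed, and it
remains to compare `At ζ(A G)` with `At X`.

A one-sided comparison is enough: for every set `W`, the probability that `At ζ(A G)` lies in `W`
exceeds that of `At X` by at most `δ/3` (`continuousGaussian_rounding_le`). Taking for `W` the
values on which `g` fails, the three errors (comparison, `g ≠ f`, `f ≠ b`) add up to `δ`.

For the comparison, `ℝⁿ` is tiled by integer translates of the unit cube, and the weight is summed
over `ℤⁿ + x` for each fixed `x`. After whitening by a linear map `H`, the integer kernel of `At`
contains `n - l` independent vectors that are very short relative to the Gaussian. By Poisson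
summation in one variable and a Gram–Schmidt induction, a sum over a coset of the lattice they span
depends, up to a factor close to one, only on the component of the shift orthogonal to that lattice
(`exists_tsum_gaussian_span_bounds`). Rounding changes this component by at most `s √n`, where `s`
bounds the norm of `H`; on `‖H x‖ ≤ M` the weight then changes by a factor near one, and Chebyshev
handles the tail. The same lattice estimate, applied to all of `ℤⁿ`, compares the normalizing
constants.

Preprocessing rests on Siegel's lemma: every choice of `4r` coordinates supports a short kernel
vector, so short kernel vectors span a space of codimension at most `4r`. Rows of `At` are an
integer basis of its orthogonal complement. -/

namespace LinearSketch

/-! ### Gaussian sums over shifted lattices with short generators. -/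

lemma hasSum_pow_natAbs {q : ℝ} (h0 : 0 ≤ q) (h1 : q < 1) :
    HasSum (fun n : ℤ => q ^ n.natAbs) ((1 - q)⁻¹ + q * (1 - q)⁻¹) := by
  refine HasSum.of_nat_of_neg_add_one (f := fun n : ℤ => q ^ n.natAbs) ?_ ?_
  · simpa using hasSum_geometric_of_lt_one h0 h1
  · have := (hasSum_geometric_of_lt_one h0 h1).mul_left q
    refine this.congr_fun fun n => ?_
    have : (-((n : ℤ) + 1)).natAbs = n + 1 := by omega
    simp only [this, pow_succ, mul_comm]

/-- A series over `ℤ` with constant term `1` and geometrically small other terms is close to `1`. -/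
lemma norm_tsum_int_sub_one_le {f : ℤ → ℂ} {q : ℝ} (hq0 : 0 ≤ q) (hq : q ≤ 1 / 8) (h0 : f 0 = 1)
    (hf : ∀ n, ‖f n‖ ≤ q ^ n.natAbs) : ‖∑' n, f n - 1‖ ≤ 4 * q := by
  have hg := hasSum_pow_natAbs hq0 (by linarith)
  have hs : Summable f := Summable.of_norm_bounded hg.summable hf
  have h1 : HasSum (fun n : ℤ => f n - if n = 0 then 1 else 0) (∑' n, f n - 1) :=
    hs.hasSum.sub (hasSum_ite_eq 0 1)
  have h2 : HasSum (fun n : ℤ => q ^ n.natAbs - if n = 0 then 1 else 0)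
      ((1 - q)⁻¹ + q * (1 - q)⁻¹ - 1) := hg.sub (hasSum_ite_eq 0 1)
  have h3 : ‖∑' n, f n - 1‖ ≤ (1 - q)⁻¹ + q * (1 - q)⁻¹ - 1 := by
    rw [← h1.tsum_eq]
    refine tsum_of_norm_bounded h2 fun n => ?_
    by_cases hn : n = 0
    · simp [hn, h0]
    · simpa [hn] using hf n
  refine h3.trans ?_
  have : 0 < 1 - q := by linarith
  rw [← sub_nonneg]
  have e : 4 * q - ((1 - q)⁻¹ + q * (1 - q)⁻¹ - 1) = (2 * q - 4 * q ^ 2) / (1 - q) := by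
    field_simp; ring
  rw [e]
  apply div_nonneg _ this.le
  nlinarith

/-- Summing a wide Gaussian over a shifted copy of `ℤ` hardly depends on the shift. -/
lemma exists_tsum_gaussian_bounds {a q : ℝ} (ha : 0 < a)
    (haq : Real.exp (-(2 * Real.pi ^ 2 / a)) ≤ q) (hq : q ≤ 1 / 8) :
    ∃ T : ℝ, 0 < T ∧ ∀ t : ℝ,
      ENNReal.ofReal T ≤ ∑' n : ℤ, ENNReal.ofReal (Real.exp (-(a * (n + t) ^ 2) / 2)) ∧
      ∑' n : ℤ, ENNReal.ofReal (Real.exp (-(a * (n + t) ^ 2) / 2)) ≤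
        ENNReal.ofReal (1 + 16 * q) * ENNReal.ofReal T := by
  have hpi := Real.pi_pos
  have hq0 : 0 < q := (Real.exp_pos _).trans_le haq
  set α : ℝ := 2 * Real.pi / a with hα
  have hα0 : 0 < α := by positivity
  -- The sum lies in `√α (1 ± 4q)`; the ratio of the two ends is at most `1 + 16q` exactly because
  -- `q ≤ 1/8`.
  refine ⟨√α * (1 - 4 * q), by have := Real.sqrt_pos.2 hα0; nlinarith, fun t => ?_⟩
  -- Poisson summation: the shift `t` becomes a phase on the dual side, where all terms but the
  -- zeroth are at most `q ^ |n|`.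
  have key := Complex.tsum_exp_neg_quadratic (a := (α : ℂ)) (by simpa using hα0) (-Complex.I * t)
  set f : ℤ → ℂ := fun n => Complex.exp (-Real.pi * α * n ^ 2 +
    2 * Real.pi * (-Complex.I * t) * n) with hf
  have hnorm : ∀ n, ‖f n‖ ≤ q ^ n.natAbs := by
    intro n
    have h1 : ‖f n‖ = Real.exp (-(2 * Real.pi ^ 2 / a)) ^ (n.natAbs ^ 2) := by
      rw [hf, Complex.norm_exp, ← Real.exp_nat_mul]
      congr 1
      have h2 : (-Real.pi * α * n ^ 2 + 2 * Real.pi * (-Complex.I * t) * n : ℂ) =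
        ((-Real.pi * α * n ^ 2 : ℝ) : ℂ) + ((-(2 * Real.pi * t * n) : ℝ) : ℂ) * Complex.I := by
        push_cast; ring
      have h3 : ((n.natAbs ^ 2 : ℕ) : ℝ) = (n : ℝ) ^ 2 := by simp [Nat.cast_natAbs, sq_abs]
      rw [h2, h3]
      simp only [Complex.add_re, Complex.ofReal_re, Complex.re_ofReal_mul, Complex.I_re, hα]
      field_simp
      ring
    rw [h1]
    calc _ ≤ q ^ (n.natAbs ^ 2) := pow_le_pow_left₀ (Real.exp_pos _).le haq _
      _ ≤ q ^ n.natAbs := pow_le_pow_of_le_one hq0.le (by linarith) (Nat.le_self_pow two_ne_zero _)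
  have hdist := norm_tsum_int_sub_one_le hq0.le hq (by simp [hf]) hnorm
  have hterm : ∀ n : ℤ, Complex.exp (-Real.pi / α * (n + Complex.I * (-Complex.I * t)) ^ 2) =
      ((Real.exp (-(a * (n + t) ^ 2) / 2) : ℝ) : ℂ) := by
    intro n
    have : Complex.I * (-Complex.I * t) = t := by
      rw [← mul_assoc, mul_neg, Complex.I_mul_I]; simp
    rw [this, Complex.ofReal_exp]
    congr 1
    have ha' : (a : ℂ) ≠ 0 := by exact_mod_cast ha.ne'
    have hp' : (Real.pi : ℂ) ≠ 0 := by exact_mod_cast hpi.ne'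
    rw [hα]; push_cast
    field_simp
  have hsq : (α : ℂ) ^ (1 / 2 : ℂ) = ((√α : ℝ) : ℂ) := by
    rw [Real.sqrt_eq_rpow, Complex.ofReal_cpow hα0.le]; norm_num
  have hsα : 0 < √α := Real.sqrt_pos.2 hα0
  simp_rw [hterm] at key
  rw [hsq] at key
  set θ : ℝ := ∑' n : ℤ, Real.exp (-(a * (n + t) ^ 2) / 2) with hθ
  have hθc : ((√α * (∑' n, f n).re : ℝ) : ℝ) = θ := by
    have h4 : (∑' n, f n) = ((1 / √α * θ : ℝ) : ℂ) := by
      rw [hf, key, hθ, Complex.ofReal_mul, Complex.ofReal_tsum]; simp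
    rw [h4, Complex.ofReal_re]; field_simp
  have hre : |(∑' n, f n).re - 1| ≤ 4 * q := by
    have := (Complex.abs_re_le_norm (∑' n, f n - 1)).trans hdist
    simpa using this
  rw [abs_le] at hre
  have hθ0 : 0 < θ := by
    rw [← hθc]; apply mul_pos hsα; linarith
  -- A divergent series would have `tsum` zero, contradicting `θ > 0`.
  have hsum : Summable fun n : ℤ => Real.exp (-(a * (n + t) ^ 2) / 2) := by
    by_contra h
    rw [hθ, tsum_eq_zero_of_not_summable h] at hθ0
    exact lt_irrefl _ hθ0
  rw [← ENNReal.ofReal_tsum_of_nonneg (fun n => (Real.exp_pos _).le) hsum, ← hθ,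
    ← ENNReal.ofReal_mul (by linarith), ← hθc]
  constructor
  · apply ENNReal.ofReal_le_ofReal
    apply mul_le_mul_of_nonneg_left _ hsα.le
    linarith
  · apply ENNReal.ofReal_le_ofReal
    rw [mul_left_comm]
    apply mul_le_mul_of_nonneg_left _ hsα.le
    nlinarith

/-- Summing a Gaussian over a shifted lattice spanned by short vectors depends, up to a factor close
to one, only on the part of the shift orthogonal to these vectors. -/
lemma exists_tsum_gaussian_span_bounds {E : Type*} [NormedAddCommGroup E] [InnerProductSpace ℝ E]
    {a q : ℝ} (haq : Real.exp (-(2 * Real.pi ^ 2 / a)) ≤ q) (hq : q ≤ 1 / 8) {k : ℕ}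
    (v : Fin k → E) (hv : LinearIndependent ℝ v) (hva : ∀ i, ‖v i‖ ^ 2 ≤ a) :
    ∃ (P : E →ₗ[ℝ] E) (T : ℝ), 0 < T ∧ (∀ i, P (v i) = 0) ∧ (∀ x, ‖P x‖ ≤ ‖x‖) ∧
      (∀ x, x - P x ∈ Submodule.span ℝ (Set.range v)) ∧ ∀ x,
      ENNReal.ofReal (T * Real.exp (-‖P x‖ ^ 2 / 2)) ≤
        ∑' m : Fin k → ℤ, ENNReal.ofReal (Real.exp (-‖x + ∑ i, m i • v i‖ ^ 2 / 2)) ∧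
      ∑' m : Fin k → ℤ, ENNReal.ofReal (Real.exp (-‖x + ∑ i, m i • v i‖ ^ 2 / 2)) ≤
        ENNReal.ofReal (1 + 16 * q) ^ k * ENNReal.ofReal (T * Real.exp (-‖P x‖ ^ 2 / 2)) := by
  induction k with
  | zero =>
    refine ⟨LinearMap.id, 1, one_pos, fun i => i.elim0, fun x => le_rfl, fun x => by simp,
      fun x => ?_⟩
    simp [tsum_fintype]
  | succ k ih =>
    rw [linearIndependent_finSucc] at hv
    obtain ⟨P, T, hT, hP0, hPle, hPs, hP⟩ := ih (Fin.tail v) hv.1 fun i => hva _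
    -- One Gram–Schmidt step: the tail vectors are summed out by induction, leaving a
    -- one-dimensional Gaussian sum along the residual `w` of `v 0`.
    set w := P (v 0) with hw
    have hw0 : w ≠ 0 := by
      intro h
      have := hPs (v 0)
      rw [← hw, h, sub_zero] at this
      exact hv.2 this
    have hwn : 0 < ‖w‖ ^ 2 := by positivity
    -- Since `P` does not lengthen vectors, `‖w‖² ≤ a`, so the same `q` serves at every step.
    obtain ⟨T', hT', hθ⟩ := exists_tsum_gaussian_bounds (a := ‖w‖ ^ 2) (q := q) hwn
      (le_trans (Real.exp_le_exp.2 (by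
        apply neg_le_neg
        apply div_le_div_of_nonneg_left (by positivity) hwn
        exact (pow_le_pow_left₀ (norm_nonneg _) (hPle _) 2).trans (hva 0))) haq) hq
    set P' : E →ₗ[ℝ] E := P - (LinearMap.toSpanSingleton ℝ E w).comp
      ((‖w‖ ^ 2)⁻¹ • (innerₗ E w).comp P) with hP'
    have hP'x : ∀ x, P' x = P x - ((‖w‖ ^ 2)⁻¹ * inner ℝ w (P x)) • w := by
      intro x; simp [hP']
    have hpyth : ∀ x (m : ℝ), ‖P x + m • w‖ ^ 2 =
        ‖P' x‖ ^ 2 + ‖w‖ ^ 2 * (m + (‖w‖ ^ 2)⁻¹ * inner ℝ w (P x)) ^ 2 := by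
      intro x m
      set s := (‖w‖ ^ 2)⁻¹ * inner ℝ w (P x) with hs
      have h1 : P x + m • w = P' x + (m + s) • w := by
        rw [hP'x, add_smul]; abel
      have h2 : inner ℝ (P' x) ((m + s) • w) = (0 : ℝ) := by
        rw [hP'x, inner_smul_right, inner_sub_left, real_inner_smul_left,
          real_inner_self_eq_norm_sq, real_inner_comm, ← hs]
        rw [hs]; field_simp; simp
      rw [h1, norm_add_sq_real, h2, norm_smul, mul_pow, Real.norm_eq_abs, sq_abs]
      ring
    refine ⟨P', T' * T, by positivity, ?_, ?_, ?_, ?_⟩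
    · intro i
      refine Fin.cases ?_ (fun j => ?_) i
      · rw [hP'x, ← hw, real_inner_self_eq_norm_sq, inv_mul_cancel₀ hwn.ne', one_smul, sub_self]
      · have := hP0 j
        rw [Fin.tail] at this
        simp [hP'x, this]
    · intro x
      have h := hpyth x 0
      have h2 : 0 ≤ ‖w‖ ^ 2 * (0 + (‖w‖ ^ 2)⁻¹ * inner ℝ w (P x)) ^ 2 := by positivity
      rw [zero_smul, add_zero] at h
      refine le_trans (abs_le_of_sq_le_sq' (by nlinarith) (norm_nonneg _)).2 (hPle x)
    · intro x
      have hspan : Submodule.span ℝ (Set.range (Fin.tail v)) ≤ Submodule.span ℝ (Set.range v) := by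
        apply Submodule.span_mono
        rintro _ ⟨i, rfl⟩
        exact ⟨i.succ, rfl⟩
      have hwm : w ∈ Submodule.span ℝ (Set.range v) := by
        have h1 := hspan (hPs (v 0))
        have h2 : v 0 ∈ Submodule.span ℝ (Set.range v) := Submodule.subset_span ⟨0, rfl⟩
        have := sub_mem h2 h1
        simpa [hw] using this
      have : x - P' x = (x - P x) + ((‖w‖ ^ 2)⁻¹ * inner ℝ w (P x)) • w := by
        rw [hP'x]; abel
      rw [this]
      exact add_mem (hspan (hPs x)) (Submodule.smul_mem _ _ hwm)
    · intro x
      have hsplit : ∑' m : Fin (k + 1) → ℤ,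
          ENNReal.ofReal (Real.exp (-‖x + ∑ i, m i • v i‖ ^ 2 / 2)) =
          ∑' m₀ : ℤ, ∑' m : Fin k → ℤ, ENNReal.ofReal
            (Real.exp (-‖(x + m₀ • v 0) + ∑ i, m i • Fin.tail v i‖ ^ 2 / 2)) := by
        rw [← (Fin.consEquiv fun _ => ℤ).tsum_eq]
        refine (ENNReal.tsum_prod (f := fun (m₀ : ℤ) (m : Fin k → ℤ) => ENNReal.ofReal (Real.exp
          (-‖x + ∑ i, (Fin.consEquiv fun _ => ℤ) (m₀, m) i • v i‖ ^ 2 / 2)))).trans ?_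
        refine tsum_congr fun m₀ => tsum_congr fun m => ?_
        rw [Fin.sum_univ_succ]
        simp [Fin.tail, add_assoc, Fin.consEquiv]
      have hPm : ∀ m₀ : ℤ, ENNReal.ofReal (T * Real.exp (-‖P (x + m₀ • v 0)‖ ^ 2 / 2)) =
          ENNReal.ofReal (T * Real.exp (-‖P' x‖ ^ 2 / 2)) * ENNReal.ofReal (Real.exp
            (-(‖w‖ ^ 2 * (m₀ + (‖w‖ ^ 2)⁻¹ * inner ℝ w (P x)) ^ 2) / 2)) := by
        intro m₀
        rw [← ENNReal.ofReal_mul (by positivity), mul_assoc, ← Real.exp_add, map_add,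
          ← Int.cast_smul_eq_zsmul ℝ, map_smul, ← hw, hpyth]
        congr 3; ring
      have hθx := hθ ((‖w‖ ^ 2)⁻¹ * inner ℝ w (P x))
      have hTT : ENNReal.ofReal (T' * T * Real.exp (-‖P' x‖ ^ 2 / 2)) =
          ENNReal.ofReal (T * Real.exp (-‖P' x‖ ^ 2 / 2)) * ENNReal.ofReal T' := by
        rw [← ENNReal.ofReal_mul (by positivity)]; congr 1; ring
      rw [hsplit, hTT]
      constructor
      · refine le_trans ?_ (ENNReal.tsum_le_tsum fun m₀ => (hP (x + m₀ • v 0)).1)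
        simp_rw [hPm]
        rw [ENNReal.tsum_mul_left]
        gcongr
        exact hθx.1
      · refine (ENNReal.tsum_le_tsum fun m₀ => (hP (x + m₀ • v 0)).2).trans ?_
        simp_rw [hPm]
        rw [ENNReal.tsum_mul_left, ENNReal.tsum_mul_left,
          pow_succ (ENNReal.ofReal (1 + 16 * q)), mul_assoc]
        refine mul_le_mul_right ?_ _
        rw [mul_left_comm]
        exact mul_le_mul_right hθx.2 _

end LinearSketch

/-! ### Comparing integrals with lattice sums, one point of the unit cube at a time. -/

namespace LinearSketch

/-- Two series over an abelian group can be compared coset by coset. -/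
lemma tsum_le_of_tsum_coset_le {A B : Type*} [AddCommGroup A] [AddCommGroup B] (φ : B →+ A)
    (hφ : Function.Injective φ) {F F' : A → ENNReal} {c : ENNReal}
    (h : ∀ a, ∑' b, F (a + φ b) ≤ c * ∑' b, F' (a + φ b)) : ∑' a, F a ≤ c * ∑' a, F' a := by
  have key : ∀ F : A → ENNReal,
      ∑' a, F a = ∑' x : A ⧸ φ.range, ∑' b, F (x.out + φ b) := by
    intro F
    rw [← (Equiv.sigmaFiberEquiv (QuotientAddGroup.mk : A → A ⧸ φ.range)).tsum_eq,
      ENNReal.tsum_sigma']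
    refine tsum_congr fun x => ?_
    have hmem : ∀ b, (QuotientAddGroup.mk (x.out + φ b) : A ⧸ φ.range) = x := by
      intro b
      conv_rhs => rw [← QuotientAddGroup.out_eq' x]
      rw [QuotientAddGroup.eq]
      exact ⟨-b, by simp⟩
    have hbij : Function.Bijective (fun b => (⟨x.out + φ b, hmem b⟩ :
        {a : A // (QuotientAddGroup.mk a : A ⧸ φ.range) = x})) := by
      constructor
      · intro b b' hb
        exact hφ (add_left_cancel (Subtype.ext_iff.1 hb))
      · rintro ⟨a, ha⟩
        have h1 : (QuotientAddGroup.mk x.out : A ⧸ φ.range) = QuotientAddGroup.mk a := by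
          rw [ha]; exact QuotientAddGroup.out_eq' x
        rw [QuotientAddGroup.eq] at h1
        obtain ⟨b, hb⟩ := h1
        exact ⟨b, Subtype.ext (by simp [hb])⟩
    rw [← (Equiv.ofBijective _ hbij).tsum_eq]
    rfl
  rw [key F, key F', ← ENNReal.tsum_mul_left]
  exact ENNReal.tsum_le_tsum fun x => h _

lemma intVec_add {n : ℕ} (x y : Fin n → ℤ) : intVec (x + y) = intVec x + intVec y := by
  ext i; simp [intVec]

lemma intVec_sub {n : ℕ} (x y : Fin n → ℤ) : intVec (x - y) = intVec x - intVec y := by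
  ext i; simp [intVec]

lemma intVec_zero {n : ℕ} : intVec (0 : Fin n → ℤ) = 0 := by
  ext i; simp [intVec]

lemma intVec_sum_smul {n k : ℕ} (m : Fin k → ℤ) (v : Fin k → Fin n → ℤ) :
    intVec (∑ i, m i • v i) = ∑ i, m i • intVec (v i) := by
  ext j; simp [intVec]

lemma measurable_intVec {n : ℕ} : Measurable (intVec : (Fin n → ℤ) → EuclideanSpace ℝ (Fin n)) :=
  measurable_of_countable _

/-- The half-open unit cube. -/
def unitCube (n : ℕ) : Set (EuclideanSpace ℝ (Fin n)) := {x | ∀ i, x i ∈ Set.Ico (0 : ℝ) 1}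

lemma measurableSet_unitCube (n : ℕ) : MeasurableSet (unitCube n) := by
  have : unitCube n = ⋂ i, (fun x : EuclideanSpace ℝ (Fin n) => x i) ⁻¹' Set.Ico (0 : ℝ) 1 := by
    ext x; simp [unitCube]
  rw [this]
  exact MeasurableSet.iInter fun i => (by fun_prop : Measurable _) measurableSet_Ico

lemma volume_unitCube (n : ℕ) : volume (unitCube n) = 1 := by
  have h := (EuclideanSpace.volume_preserving_symm_measurableEquiv_toLp (Fin n)).symm
  have h2 : unitCube n = (MeasurableEquiv.toLp 2 (Fin n → ℝ)).symm ⁻¹'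
      (Set.univ.pi fun _ => Set.Ico (0 : ℝ) 1) := by
    ext x; simp [unitCube]
  rw [h2, (EuclideanSpace.volume_preserving_symm_measurableEquiv_toLp (Fin n)).measure_preimage
    (MeasurableSet.univ_pi fun _ => measurableSet_Ico).nullMeasurableSet, Real.volume_pi_Ico]
  simp

/-- Integration over Euclidean space, tiled by integer translates of the unit cube. -/
lemma lintegral_eq_setLIntegral_unitCube {n : ℕ} {f : EuclideanSpace ℝ (Fin n) → ENNReal}
    (hf : Measurable f) :
    ∫⁻ x, f x = ∫⁻ x in unitCube n, ∑' z : Fin n → ℤ, f (intVec z + x) := by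
  have hQ := measurableSet_unitCube n
  have hpt : ∀ x, f x = ∑' z : Fin n → ℤ, (unitCube n).indicator 1 (x - intVec z) * f x := by
    intro x
    rw [tsum_eq_single (fun i => ⌊x i⌋)]
    · rw [Set.indicator_of_mem]
      · simp
      · intro i
        simp only [intVec, PiLp.sub_apply]
        exact ⟨by have := Int.floor_le (x i); linarith,
          by have := Int.lt_floor_add_one (x i); linarith⟩
    · intro z hz
      rw [Set.indicator_of_notMem, zero_mul]
      intro hx
      apply hz
      ext i
      have := hx i
      simp only [intVec, PiLp.sub_apply] at this
      symm
      rw [Int.floor_eq_iff]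
      exact ⟨by linarith [this.1], by linarith [this.2]⟩
  have hm : ∀ z : Fin n → ℤ, Measurable fun x => (unitCube n).indicator 1 (x - intVec z) * f x :=
    fun z => ((measurable_one.indicator hQ).comp (measurable_id.sub_const _)).mul hf
  calc ∫⁻ x, f x = ∫⁻ x, ∑' z : Fin n → ℤ, (unitCube n).indicator 1 (x - intVec z) * f x :=
        lintegral_congr hpt
    _ = ∑' z : Fin n → ℤ, ∫⁻ x, (unitCube n).indicator 1 (x - intVec z) * f x :=
        lintegral_tsum fun z => (hm z).aemeasurable
    _ = ∑' z : Fin n → ℤ, ∫⁻ x, (unitCube n).indicator 1 x * f (intVec z + x) := by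
        refine tsum_congr fun z => ?_
        rw [← lintegral_add_left_eq_self _ (intVec z)]
        simp
    _ = ∫⁻ x, ∑' z : Fin n → ℤ, (unitCube n).indicator 1 x * f (intVec z + x) := by
        rw [lintegral_tsum]
        exact fun z => ((measurable_one.indicator hQ).mul
          (hf.comp (measurable_const_add _))).aemeasurable
    _ = _ := by
        rw [← lintegral_indicator hQ]
        refine lintegral_congr fun x => ?_
        rw [ENNReal.tsum_mul_left]
        by_cases hx : x ∈ unitCube n <;> simp [hx]

/-- The Gaussian weight `exp (-‖H x‖² / 2)`. -/
noncomputable def normWeight {n : ℕ} (H : EuclideanSpace ℝ (Fin n) →ₗ[ℝ] EuclideanSpace ℝ (Fin n))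
    (x : EuclideanSpace ℝ (Fin n)) : ENNReal :=
  ENNReal.ofReal (Real.exp (-‖H x‖ ^ 2 / 2))

variable {n : ℕ} {H : EuclideanSpace ℝ (Fin n) →ₗ[ℝ] EuclideanSpace ℝ (Fin n)}

lemma measurable_normWeight : Measurable (normWeight H) := by
  have : Measurable H := H.continuous_of_finiteDimensional.measurable
  unfold normWeight
  fun_prop

/-- The weight of all integer points is at most the total integral, up to a factor close to one. -/
lemma tsum_normWeight_le_lintegral {a q : ℝ} (haq : Real.exp (-(2 * Real.pi ^ 2 / a)) ≤ q)
    (hq : q ≤ 1 / 8) (hH : Function.Injective H)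
    (ha : ∀ i : Fin n, ‖H (EuclideanSpace.single i 1)‖ ^ 2 ≤ a) :
    ∑' z : Fin n → ℤ, normWeight H (intVec z) ≤
      ENNReal.ofReal (1 + 16 * q) ^ n * ∫⁻ x, normWeight H x := by
  set b := EuclideanSpace.basisFun (Fin n) ℝ with hb
  have hbi : ∀ i, b i = EuclideanSpace.single i 1 := fun i => by simp [hb]
  obtain ⟨P, T, hT, hP0, -, -, hP⟩ := exists_tsum_gaussian_span_bounds haq hq (fun i => H (b i))
    (b.toBasis.linearIndependent.map' H (LinearMap.ker_eq_bot.2 hH) |> fun h => by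
      simpa [Function.comp_def] using h) (fun i => by rw [hbi]; exact ha i)
  -- The generators span the whole image of `H`, so every shifted sum lies between `T` and `(1 +
  -- 16q)ⁿ T`. The integral averages these sums over a cube of volume one.
  have hPH : ∀ x, P (H x) = 0 := by
    have : P ∘ₗ H = 0 := b.toBasis.ext fun i => by simpa using hP0 i
    exact fun x => LinearMap.congr_fun this x
  have hsum : ∀ x, ∑' z : Fin n → ℤ, normWeight H (intVec z + x) =
      ∑' m : Fin n → ℤ, ENNReal.ofReal (Real.exp (-‖H x + ∑ i, m i • H (b i)‖ ^ 2 / 2)) := by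
    intro x
    refine tsum_congr fun z => ?_
    have : intVec z = ∑ i, z i • b i := by
      ext j
      simp [intVec, hbi, Finset.sum_apply, Pi.single_apply]
    rw [normWeight, map_add, this, map_sum, add_comm]
    simp_rw [map_zsmul]
  rw [lintegral_eq_setLIntegral_unitCube measurable_normWeight]
  have h1 : ∀ x ∈ unitCube n, ENNReal.ofReal T ≤ ∑' z : Fin n → ℤ, normWeight H (intVec z + x) := by
    intro x _
    have := (hP (H x)).1
    rw [hPH] at this
    rw [hsum]
    simpa using this
  have h0 : ∑' z : Fin n → ℤ, normWeight H (intVec z) ≤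
      ENNReal.ofReal (1 + 16 * q) ^ n * ENNReal.ofReal T := by
    have h := (hP (H 0)).2
    rw [hPH, ← hsum] at h
    simpa using h
  refine h0.trans (mul_le_mul_right ?_ _)
  calc ENNReal.ofReal T = ∫⁻ x in unitCube n, ENNReal.ofReal T := by
        rw [setLIntegral_const, volume_unitCube, mul_one]
    _ ≤ _ := setLIntegral_mono' (measurableSet_unitCube n) h1

/-- Rounding the image of a continuous Gaussian: the integral of the weight over the points rounded
into a set `U` of integer points is at most the weight of `U`, up to a factor close to one. -/
lemma setLIntegral_normWeight_le_tsum {a q s d M : ℝ} {k l : ℕ} {A : Matrix (Fin l) (Fin n) ℝ}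
    (haq : Real.exp (-(2 * Real.pi ^ 2 / a)) ≤ q) (hq : q ≤ 1 / 8) (hs : 0 ≤ s)
    (hH : Function.Injective H) (hHs : ∀ x, ‖H x‖ ≤ s * ‖x‖)
    {v : Fin k → Fin n → ℤ} (hv : LinearIndependent ℝ fun i => intVec (v i))
    (hva : ∀ i, ‖H (intVec (v i))‖ ^ 2 ≤ a)
    (hA : ∀ x, ∃ y, x - y ∈ Submodule.span ℝ (Set.range fun i => intVec (v i)) ∧
      ‖y‖ ≤ ‖sketch A x‖)
    {ζ : EuclideanSpace ℝ (Fin l) → Fin n → ℤ} (hζ : Measurable ζ)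
    (hζd : ∀ w, ‖w - sketch A (intVec (ζ w))‖ ≤ d) {U : Set (Fin n → ℤ)}
    (hU : ∀ z (m : Fin k → ℤ), z + ∑ i, m i • v i ∈ U ↔ z ∈ U)
    (hζU : ∀ z w, ζ (sketch A (intVec z) + w) ∈ U ↔ z + ζ w ∈ U) :
    ∫⁻ x in {x | ‖H x‖ ≤ M ∧ ζ (sketch A x) ∈ U}, normWeight H x ≤
      ENNReal.ofReal (1 + 16 * q) ^ k * ENNReal.ofReal (Real.exp (M * (s * d) + (s * d) ^ 2 / 2)) *
        ∑' z : Fin n → ℤ, U.indicator (fun z => normWeight H (intVec z)) z := by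
  classical
  have hHm : Measurable H := H.continuous_of_finiteDimensional.measurable
  have hAm : Measurable (sketch A) :=
    (Matrix.toEuclideanLin A).continuous_of_finiteDimensional.measurable
  have hAadd : ∀ x y, sketch A (x + y) = sketch A x + sketch A y :=
    fun x y => (Matrix.toEuclideanLin A).map_add x y
  have hAsub : ∀ x y, sketch A (x - y) = sketch A x - sketch A y :=
    fun x y => (Matrix.toEuclideanLin A).map_sub x y
  obtain ⟨P, T, hT, hP0, hPle, -, hP⟩ := exists_tsum_gaussian_span_bounds haq hq
    (fun i => H (intVec (v i)))
    (by simpa [Function.comp_def] using hv.map' H (LinearMap.ker_eq_bot.2 hH)) hva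
  have hPm : Measurable fun x => P (H x) := (P ∘ₗ H).continuous_of_finiteDimensional.measurable
  have hPHspan : ∀ u ∈ Submodule.span ℝ (Set.range fun i => intVec (v i)), P (H u) = 0 := by
    intro u hu
    have : Submodule.span ℝ (Set.range fun i => intVec (v i)) ≤ LinearMap.ker (P ∘ₗ H) := by
      rw [Submodule.span_le]
      rintro _ ⟨i, rfl⟩
      exact hP0 i
    exact this hu
  -- Modulo the kernel directions, which `P ∘ H` kills, `r` has a representative no longer than its
  -- sketch. Hence only the displacement of the sketch matters, however far `r` itself is from zero.
  have hPr : ∀ r, ‖sketch A r‖ ≤ d → ‖P (H r)‖ ≤ s * d := by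
    intro r hr
    obtain ⟨y, hy, hyr⟩ := hA r
    have h1 : P (H r) = P (H y) := by
      have := hPHspan _ hy
      rwa [map_sub, map_sub, sub_eq_zero] at this
    rw [h1]
    exact (hPle _).trans ((hHs _).trans (mul_le_mul_of_nonneg_left (hyr.trans hr) hs))
  have hd : 0 ≤ d := (norm_nonneg _).trans (hζd 0)
  -- The truncation is weakened from `‖H x‖` to `‖P (H x)‖`, which is constant on cosets of the
  -- kernel lattice.
  set D : Set (EuclideanSpace ℝ (Fin n)) := {x | ‖P (H x)‖ ≤ M ∧ ζ (sketch A x) ∈ U} with hD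
  have hDm : MeasurableSet D :=
    (measurableSet_le hPm.norm measurable_const).inter
      ((hζ.comp hAm) (MeasurableSet.of_discrete (s := U)))
  have hsub : {x | ‖H x‖ ≤ M ∧ ζ (sketch A x) ∈ U} ⊆ D := fun x hx => ⟨(hPle _).trans hx.1, hx.2⟩
  refine (lintegral_mono_set hsub).trans ?_
  rw [← lintegral_indicator hDm,
    lintegral_eq_setLIntegral_unitCube (measurable_normWeight.indicator hDm)]
  set φ : (Fin k → ℤ) →+ (Fin n → ℤ) :=
    { toFun := fun m => ∑ i, m i • v i
      map_zero' := by simp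
      map_add' := fun m m' => by simp [add_smul, Finset.sum_add_distrib] } with hφ
  have hφi : Function.Injective φ := by
    rw [injective_iff_map_eq_zero]
    intro m hm
    have h1 : ∑ i, ((m i : ℤ) : ℝ) • intVec (v i) = 0 := by
      have h2 : intVec (∑ i, m i • v i) = 0 := by
        have : (∑ i, m i • v i) = 0 := hm
        rw [this, intVec_zero]
      rw [intVec_sum_smul] at h2
      simpa [Int.cast_smul_eq_zsmul] using h2
    ext i
    have := Fintype.linearIndependent_iff.1 hv _ h1 i
    exact_mod_cast this
  set C := ENNReal.ofReal (1 + 16 * q) ^ k *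
    ENNReal.ofReal (Real.exp (M * (s * d) + (s * d) ^ 2 / 2)) with hC
  have hpt : ∀ x, ∑' z : Fin n → ℤ, D.indicator (normWeight H) (intVec z + x) ≤
      C * ∑' z : Fin n → ℤ, U.indicator (fun z => normWeight H (intVec z)) z := by
    intro x
    set z₀ := ζ (sketch A x) with hz₀
    set r := x - intVec z₀ with hr
    have hrn : ‖P (H r)‖ ≤ s * d := hPr r (by rw [hr, hAsub]; exact hζd _)
    have hshift : ∀ z, intVec (z - z₀) + x = intVec z + r := by
      intro z; rw [intVec_sub, hr]; abel
    -- After re-indexing by `z₀ = ζ (A x)`, equivariance turns the condition on the rounded point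
    -- into `z ∈ U`, and both sums run over the same `z`.
    have hDz : ∀ z, intVec z + r ∈ D ↔ ‖P (H (intVec z + r))‖ ≤ M ∧ z ∈ U := by
      intro z
      rw [hD, Set.mem_ofPred_eq, ← hshift, hAadd, hζU, ← hz₀, sub_add_cancel]
    rw [← (Equiv.subRight z₀).tsum_eq]
    simp only [Equiv.subRight_apply, hshift]
    refine tsum_le_of_tsum_coset_le φ hφi fun z => ?_
    have hφU : ∀ m, z + φ m ∈ U ↔ z ∈ U := fun m => hU z m
    have hφP : ∀ m, P (H (intVec (z + φ m) + r)) = P (H (intVec z + r)) := by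
      intro m
      have h1 : intVec (z + φ m) + r = (intVec z + r) + ∑ i, m i • intVec (v i) := by
        rw [intVec_add, ← intVec_sum_smul]; simp only [hφ, AddMonoidHom.coe_mk, ZeroHom.coe_mk]
        abel
      rw [h1, map_add, map_add, hPHspan (∑ i, m i • intVec (v i)), add_zero]
      exact Submodule.sum_mem _ fun i _ => by
        rw [← Int.cast_smul_eq_zsmul ℝ]
        exact Submodule.smul_mem _ _ (Submodule.subset_span ⟨i, rfl⟩)
    by_cases hz : z ∈ U ∧ ‖P (H (intVec z + r))‖ ≤ M
    swap
    · have : ∀ m, D.indicator (normWeight H) (intVec (z + φ m) + r) = 0 := by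
        intro m
        apply Set.indicator_of_notMem
        rw [hDz, hφU, hφP]
        tauto
      simp [this]
    have hw : ∀ y (m : Fin k → ℤ), normWeight H (intVec (z + φ m) + y) =
        ENNReal.ofReal (Real.exp
          (-‖H (intVec z + y) + ∑ i, m i • H (intVec (v i))‖ ^ 2 / 2)) := by
      intro y m
      have h1 : intVec (z + φ m) + y = (intVec z + y) + ∑ i, m i • intVec (v i) := by
        rw [intVec_add, ← intVec_sum_smul]; simp only [hφ, AddMonoidHom.coe_mk, ZeroHom.coe_mk]
        abel
      rw [normWeight, h1, map_add, map_sum]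
      simp_rw [map_zsmul]
    have hL : ∑' m, D.indicator (normWeight H) (intVec (z + φ m) + r) ≤
        ENNReal.ofReal (1 + 16 * q) ^ k *
          ENNReal.ofReal (T * Real.exp (-‖P (H (intVec z + r))‖ ^ 2 / 2)) := by
      refine le_trans (ENNReal.tsum_le_tsum fun m => ?_) (hP (H (intVec z + r))).2
      rw [← hw]
      exact Set.indicator_le_self _ _ _
    have hR : ENNReal.ofReal (T * Real.exp (-‖P (H (intVec z))‖ ^ 2 / 2)) ≤
        ∑' m, U.indicator (fun z => normWeight H (intVec z)) (z + φ m) := by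
      refine (hP (H (intVec z))).1.trans (ENNReal.tsum_le_tsum fun m => ?_)
      rw [Set.indicator_of_mem ((hφU m).2 hz.1)]
      have := hw 0 m
      rw [add_zero, add_zero] at this
      rw [this]
    refine hL.trans (le_trans ?_ (mul_le_mul_right hR C))
    rw [hC, mul_assoc]
    refine mul_le_mul_right ?_ _
    rw [← ENNReal.ofReal_mul (Real.exp_pos _).le]
    apply ENNReal.ofReal_le_ofReal
    rw [mul_left_comm, ← Real.exp_add]
    refine mul_le_mul_of_nonneg_left (Real.exp_le_exp.2 ?_) hT.le
    -- With `p ≤ u + sd` and `u ≤ M`, `p²/2` exceeds `u²/2` by at most `M s d + (sd)²/2`.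
    have h1 : ‖P (H (intVec z))‖ ≤ ‖P (H (intVec z + r))‖ + ‖P (H r)‖ := by
      have : P (H (intVec z)) = P (H (intVec z + r)) - P (H r) := by
        rw [map_add, map_add]; abel
      rw [this]; exact norm_sub_le _ _
    set p := ‖P (H (intVec z))‖
    set u := ‖P (H (intVec z + r))‖
    have hp : 0 ≤ p := norm_nonneg _
    have hu : 0 ≤ u := norm_nonneg _
    have hsd : 0 ≤ s * d := mul_nonneg hs hd
    have h2 : p ≤ u + s * d := by linarith
    have h3 : p ^ 2 ≤ (u + s * d) ^ 2 := pow_le_pow_left₀ hp h2 2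
    nlinarith [mul_le_mul_of_nonneg_right hz.2 hsd]
  calc ∫⁻ x in unitCube n, ∑' z : Fin n → ℤ, D.indicator (normWeight H) (intVec z + x)
      ≤ ∫⁻ x in unitCube n, C * ∑' z : Fin n → ℤ, U.indicator (fun z => normWeight H (intVec z)) z :=
        lintegral_mono fun x => hpt x
    _ = _ := by rw [setLIntegral_const, volume_unitCube, mul_one]

end LinearSketch

/-! ### The lattice `A ℤⁿ` and an equivariant rounding to it. -/

namespace LinearSketch

variable {m n l : ℕ}

lemma sketch_add (A : Matrix (Fin m) (Fin n) ℝ) (x y : EuclideanSpace ℝ (Fin n)) :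
    sketch A (x + y) = sketch A x + sketch A y := (Matrix.toEuclideanLin A).map_add x y

lemma sketch_sub (A : Matrix (Fin m) (Fin n) ℝ) (x y : EuclideanSpace ℝ (Fin n)) :
    sketch A (x - y) = sketch A x - sketch A y := (Matrix.toEuclideanLin A).map_sub x y

lemma measurable_sketch (A : Matrix (Fin m) (Fin n) ℝ) : Measurable (sketch A) :=
  (Matrix.toEuclideanLin A).continuous_of_finiteDimensional.measurable

lemma sketch_mul (C : Matrix (Fin l) (Fin m) ℝ) (A : Matrix (Fin m) (Fin n) ℝ)
    (x : EuclideanSpace ℝ (Fin n)) : sketch (C * A) x = sketch C (sketch A x) := by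
  ext i; simp [sketch, Matrix.toLpLin_apply]

lemma sketch_one (x : EuclideanSpace ℝ (Fin n)) : sketch 1 x = x := by
  ext i; simp [sketch]

lemma sketch_toReal_intVec (At : Matrix (Fin m) (Fin n) ℤ) (z : Fin n → ℤ) :
    sketch (toReal At) (intVec z) = intVec (At *ᵥ z) := by
  ext i; simp [sketch, intVec, toReal, Matrix.toLpLin_apply, Matrix.mulVec, dotProduct]

lemma intVec_injective : Function.Injective (intVec : (Fin n → ℤ) → EuclideanSpace ℝ (Fin n)) := by
  intro x y h
  ext i
  have := congrArg (fun u : EuclideanSpace ℝ (Fin n) => u i) h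
  simpa [intVec] using this

lemma exists_eq_mul_of_rowSpan_le {A : Matrix (Fin m) (Fin n) ℝ} {B : Matrix (Fin l) (Fin n) ℝ}
    (h : rowSpan A ≤ rowSpan B) : ∃ C : Matrix (Fin m) (Fin l) ℝ, A = C * B := by
  have h1 : ∀ i, ∃ c : Fin l → ℝ, ∑ j, c j • B.row j = A.row i := fun i =>
    (Submodule.mem_span_range_iff_exists_fun ℝ).1 (h (Submodule.subset_span ⟨i, rfl⟩))
  choose C hC using h1
  refine ⟨Matrix.of C, ?_⟩
  ext i j
  have := congrFun (hC i) j
  simp only [Finset.sum_apply, Pi.smul_apply, Matrix.row, smul_eq_mul] at this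
  rw [← this, Matrix.mul_apply]
  rfl

lemma norm_sketch_transpose {A : Matrix (Fin l) (Fin n) ℝ} (hA : RowOrthonormal A)
    (w : EuclideanSpace ℝ (Fin l)) : ‖sketch Aᵀ w‖ = ‖w‖ := by
  rw [← sq_eq_sq₀ (norm_nonneg _) (norm_nonneg _), ← real_inner_self_eq_norm_sq,
    ← real_inner_self_eq_norm_sq]
  have h1 : (Aᵀ *ᵥ w.ofLp) ⬝ᵥ (Aᵀ *ᵥ w.ofLp) = w.ofLp ⬝ᵥ w.ofLp := by
    have : A * Aᵀ = 1 := hA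
    rw [Matrix.dotProduct_mulVec, Matrix.vecMul_transpose, Matrix.mulVec_mulVec, this,
      Matrix.one_mulVec]
  simpa only [sketch, Matrix.toLpLin_apply, EuclideanSpace.inner_eq_star_dotProduct, star_trivial]
    using h1

lemma sketch_sketch_transpose {A : Matrix (Fin l) (Fin n) ℝ} (hA : RowOrthonormal A)
    (w : EuclideanSpace ℝ (Fin l)) : sketch A (sketch Aᵀ w) = w := by
  have : A * Aᵀ = 1 := hA
  rw [← sketch_mul, this, sketch_one]

lemma norm_sketch_le {A : Matrix (Fin l) (Fin n) ℝ} (hA : RowOrthonormal A)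
    (x : EuclideanSpace ℝ (Fin n)) : ‖sketch A x‖ ≤ ‖x‖ := by
  have h1 : inner ℝ (sketch Aᵀ (sketch A x)) x = ‖sketch A x‖ ^ 2 := by
    rw [← real_inner_self_eq_norm_sq]
    simp only [sketch, Matrix.toLpLin_apply, EuclideanSpace.inner_eq_star_dotProduct,
      star_trivial]
    rw [Matrix.dotProduct_mulVec, Matrix.vecMul_transpose]
  have h2 := real_inner_le_norm (sketch Aᵀ (sketch A x)) x
  rw [h1, norm_sketch_transpose hA] at h2
  rcases (norm_nonneg (sketch A x)).eq_or_lt with h | h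
  · rw [← h]; exact norm_nonneg _
  · nlinarith

lemma norm_le_sqrt_of_forall_abs_le_one {x : EuclideanSpace ℝ (Fin n)} (h : ∀ i, |x i| ≤ 1) :
    ‖x‖ ≤ √n := by
  rw [EuclideanSpace.norm_eq]
  apply Real.sqrt_le_sqrt
  calc ∑ i, ‖x i‖ ^ 2 ≤ ∑ i : Fin n, (1 : ℝ) := Finset.sum_le_sum fun i _ => by
        rw [Real.norm_eq_abs]; exact pow_le_one₀ (abs_nonneg _) (h i)
    _ = n := by simp

/-- The image of `ℤⁿ` under `A`, a lattice if `A` has the row span of an integer matrix. -/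
noncomputable def sketchLattice (A : Matrix (Fin l) (Fin n) ℝ) :
    Submodule ℤ (EuclideanSpace ℝ (Fin l)) :=
  LinearMap.range (AddMonoidHom.toIntLinearMap
    (AddMonoidHom.mk' (fun z : Fin n → ℤ => sketch A (intVec z))
      fun x y => by rw [intVec_add, sketch_add]))

lemma mem_sketchLattice {A : Matrix (Fin l) (Fin n) ℝ} {w : EuclideanSpace ℝ (Fin l)} :
    w ∈ sketchLattice A ↔ ∃ z, sketch A (intVec z) = w := Iff.rfl

/-- Writing `At = C A`, the map `C` is injective because `A` and `At` have the same row span, and it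
carries `A ℤⁿ` continuously into the discrete lattice `ℤᵐ`. Rationality of the row span is
essential: for a general `A` the image of `ℤⁿ` may be dense. -/
lemma discreteTopology_sketchLattice {A : Matrix (Fin l) (Fin n) ℝ} {At : Matrix (Fin m) (Fin n) ℤ}
    (hA : RowOrthonormal A) (h : rowSpan A = rowSpan (toReal At)) :
    DiscreteTopology (sketchLattice A) := by
  obtain ⟨C, hC⟩ := exists_eq_mul_of_rowSpan_le h.ge
  obtain ⟨D, hD⟩ := exists_eq_mul_of_rowSpan_le h.le
  have hDC : D * C = 1 := by
    have hA' : A * Aᵀ = 1 := hA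
    calc D * C = D * C * (A * Aᵀ) := by rw [hA', Matrix.mul_one]
      _ = D * (C * A) * Aᵀ := by simp only [Matrix.mul_assoc]
      _ = 1 := by rw [← hC, ← hD, hA']
  have hmaps : Set.MapsTo (fun w => (sketch C w).ofLp) (sketchLattice A)
      (Submodule.span ℤ (Set.range (Pi.basisFun ℝ (Fin m)))) := by
    rintro _ ⟨z, rfl⟩
    have : sketch C (sketch A (intVec z)) = intVec (At *ᵥ z) := by
      rw [← sketch_mul, ← hC, sketch_toReal_intVec]
    change (sketch C (sketch A (intVec z))).ofLp ∈ _
    rw [this, SetLike.mem_coe, Module.Basis.mem_span_iff_repr_mem]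
    exact fun i => ⟨(At *ᵥ z) i, by simp [intVec]⟩
  have hcont : Continuous fun w => (sketch C w).ofLp :=
    (PiLp.continuous_ofLp 2 _).comp (Matrix.toEuclideanLin C).continuous_of_finiteDimensional
  have hinj : Function.Injective fun w => (sketch C w).ofLp := by
    intro x y hxy
    have : sketch C x = sketch C y := WithLp.ofLp_injective 2 hxy
    have := congrArg (sketch D) this
    rwa [← sketch_mul, ← sketch_mul, hDC, sketch_one, sketch_one] at this
  have hdisc := ZSpan.discreteTopology_pi_basisFun (ι := Fin m)
  exact DiscreteTopology.of_continuous_injective (hcont.restrict hmaps)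
    ((hmaps.restrict_inj).2 hinj.injOn)

lemma span_sketchLattice {A : Matrix (Fin l) (Fin n) ℝ} (hA : RowOrthonormal A) :
    Submodule.span ℝ (sketchLattice A : Set (EuclideanSpace ℝ (Fin l))) = ⊤ := by
  rw [eq_top_iff]
  intro w _
  have h1 : w = ∑ j, (sketch Aᵀ w) j • sketch A (intVec (Pi.single j 1)) := by
    conv_lhs => rw [← sketch_sketch_transpose hA w]
    have h2 : sketch Aᵀ w = ∑ j, (sketch Aᵀ w) j • intVec (Pi.single j 1) := by
      ext i
      simp [intVec, Pi.single_apply]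
    conv_lhs => rw [h2]
    simp only [sketch, map_sum, map_smul]
  rw [h1]
  exact Submodule.sum_mem _ fun j _ => Submodule.smul_mem _ _ (Submodule.subset_span ⟨_, rfl⟩)

/-- A measurable rounding of `ℝˡ` to the lattice `A ℤⁿ`, with bounded displacement and equivariant
under translation by the lattice. -/
lemma exists_measurable_rounding {A : Matrix (Fin l) (Fin n) ℝ} {At : Matrix (Fin m) (Fin n) ℤ}
    (hA : RowOrthonormal A) (h : rowSpan A = rowSpan (toReal At)) :
    ∃ ζ : EuclideanSpace ℝ (Fin l) → Fin n → ℤ, Measurable ζ ∧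
      (∀ w, ‖w - sketch A (intVec (ζ w))‖ ≤ √n) ∧
      ∀ z w, sketch A (intVec (ζ (sketch A (intVec z) + w))) = sketch A (intVec (z + ζ w)) := by
  have hd := discreteTopology_sketchLattice hA h
  have hZ : IsZLattice ℝ (sketchLattice A) := ⟨span_sketchLattice hA⟩
  set b₀ := Module.Free.chooseBasis ℤ (sketchLattice A)
  set b := b₀.ofZLatticeBasis ℝ (sketchLattice A) with hb
  have hbL : ∀ c : Module.Free.ChooseBasisIndex ℤ (sketchLattice A) → ℤ,
      ∃ z, sketch A (intVec z) = ∑ i, c i • b i := by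
    intro c
    rw [← mem_sketchLattice]
    refine Submodule.sum_mem _ fun i _ => Submodule.smul_mem _ _ ?_
    rw [hb, Module.Basis.ofZLatticeBasis_apply]
    exact (b₀ i).2
  choose pre hpre using hbL
  set fl : EuclideanSpace ℝ (Fin l) → Module.Free.ChooseBasisIndex ℤ (sketchLattice A) → ℤ :=
    fun w i => ⌊b.repr w i⌋ with hfl
  -- The residue of `w` in a fundamental parallelepiped; it is periodic under the lattice, but
  -- possibly long since the basis is not controlled.
  set fr : EuclideanSpace ℝ (Fin l) → EuclideanSpace ℝ (Fin l) :=
    fun w => w - sketch A (intVec (pre (fl w))) with hfr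
  have hflm : Measurable fl := by
    refine measurable_pi_lambda _ fun i => Int.measurable_floor.comp ?_
    exact (b.coord i).continuous_of_finiteDimensional.measurable
  have hprem : Measurable fun w => pre (fl w) := (measurable_of_countable pre).comp hflm
  have hfrm : Measurable fr :=
    measurable_id.sub ((measurable_sketch A).comp (measurable_intVec.comp hprem))
  have hfladd : ∀ z w, sketch A (intVec (pre (fl (sketch A (intVec z) + w)))) =
      sketch A (intVec z) + sketch A (intVec (pre (fl w))) := by
    intro z w
    set y : sketchLattice A := ⟨sketch A (intVec z), mem_sketchLattice.2 ⟨z, rfl⟩⟩ with hy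
    have h1 : ∀ i, fl (sketch A (intVec z) + w) i = b₀.repr y i + fl w i := by
      intro i
      have : b.repr (sketch A (intVec z)) i = b₀.repr y i :=
        b₀.ofZLatticeBasis_repr_apply ℝ (sketchLattice A) y i
      simp only [hfl, map_add, Finsupp.add_apply, this]
      rw [Int.floor_intCast_add]
    have h2 : ∑ i, (b₀.repr y i) • b i = sketch A (intVec z) := by
      have h3 := congrArg (Subtype.val) (b₀.sum_repr y)
      simp only [AddSubmonoidClass.coe_finsetSum, SetLike.val_smul] at h3
      simpa [hb] using h3
    rw [hpre, hpre]
    simp_rw [h1, add_smul, Finset.sum_add_distrib]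
    rw [h2]
  have hfradd : ∀ z w, fr (sketch A (intVec z) + w) = fr w := by
    intro z w
    simp only [hfr, hfladd]
    abel
  -- The residue is lifted to `ℝⁿ` by `Aᵀ` and rounded coordinatewise, which leaves an error in the
  -- unit cube and hence of norm at most `√n`. Periodicity of the residue preserves equivariance.
  refine ⟨fun w => pre (fl w) + fun j => ⌊sketch Aᵀ (fr w) j⌋, ?_, ?_, ?_⟩
  · refine hprem.add (measurable_pi_lambda _ fun j => Int.measurable_floor.comp ?_)
    have := (measurable_sketch Aᵀ).comp hfrm
    fun_prop
  · intro w
    have h1 : w - sketch A (intVec (pre (fl w) + fun j => ⌊sketch Aᵀ (fr w) j⌋)) =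
        sketch A (sketch Aᵀ (fr w) - intVec fun j => ⌊sketch Aᵀ (fr w) j⌋) := by
      have h0 : fr w = w - sketch A (intVec (pre (fl w))) := rfl
      rw [sketch_sub A (sketch Aᵀ (fr w)), sketch_sketch_transpose hA, intVec_add, sketch_add]
      nth_rw 2 [h0]
      abel
    rw [h1]
    refine (norm_sketch_le hA _).trans (norm_le_sqrt_of_forall_abs_le_one fun j => ?_)
    simp only [PiLp.sub_apply, intVec]
    rw [abs_le]
    have h2 := Int.floor_le (sketch Aᵀ (fr w) j)
    have h3 := Int.lt_floor_add_one (sketch Aᵀ (fr w) j)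
    constructor <;> linarith
  · intro z w
    simp only [hfradd, intVec_add, sketch_add, hfladd, add_assoc]

/-- If the short integer vectors `v` span the kernel, a vector differs from one whose norm is that
of its sketch by an element of their span. -/
lemma exists_norm_le_norm_sketch {A : Matrix (Fin l) (Fin n) ℝ} (hA : RowOrthonormal A)
    {v : Fin (n - l) → EuclideanSpace ℝ (Fin n)} (hv : LinearIndependent ℝ v)
    (hv0 : ∀ i, sketch A (v i) = 0) (x : EuclideanSpace ℝ (Fin n)) :
    ∃ y, x - y ∈ Submodule.span ℝ (Set.range v) ∧ ‖y‖ ≤ ‖sketch A x‖ := by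
  refine ⟨sketch Aᵀ (sketch A x), ?_, (norm_sketch_transpose hA _).le⟩
  have hle : Submodule.span ℝ (Set.range v) ≤ LinearMap.ker (Matrix.toEuclideanLin A) := by
    rw [Submodule.span_le]
    rintro _ ⟨i, rfl⟩
    exact hv0 i
  have hsurj : LinearMap.range (Matrix.toEuclideanLin A) = ⊤ :=
    LinearMap.range_eq_top.2 fun w => ⟨_, sketch_sketch_transpose hA w⟩
  have hrank := LinearMap.finrank_range_add_finrank_ker (Matrix.toEuclideanLin A)
  rw [hsurj, finrank_top, finrank_euclideanSpace_fin, finrank_euclideanSpace_fin] at hrank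
  -- `A` is onto, so its kernel has dimension `n - l` and is filled by the span of the `v i`; it
  -- contains `x - Aᵀ A x`.
  have heq := Submodule.eq_of_le_of_finrank_eq hle (by
    rw [finrank_span_eq_card hv, Fintype.card_fin]; omega)
  rw [heq, LinearMap.mem_ker, map_sub, sub_eq_zero]
  exact (sketch_sketch_transpose hA _).symm

end LinearSketch

/-! ### The continuous Gaussian: density, tail and whitening. -/

namespace LinearSketch

open scoped MatrixOrder RealInnerProductSpace

variable {n : ℕ}

/-- The standard Gaussian has density proportional to `exp (-‖x‖² / 2)`. -/
lemma exists_stdGaussian_eq_smul_withDensity (n : ℕ) :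
    ∃ c : ENNReal, stdGaussian (EuclideanSpace ℝ (Fin n)) =
      c • volume.withDensity fun x => ENNReal.ofReal (Real.exp (-‖x‖ ^ 2 / 2)) := by
  set p : ℝ := (2 * Real.pi) ^ (n / 2 : ℝ) with hp
  have hp0 : 0 < p := by positivity
  have hb : 0 < (1 / 2 : ℂ).re := by norm_num
  have hcp : ((Real.pi : ℂ) / (1 / 2)) ^ (n / 2 : ℂ) = (p : ℂ) := by
    rw [hp, Complex.ofReal_cpow (by positivity)]
    push_cast
    congr 1
    ring
  have hfm : Measurable fun x : EuclideanSpace ℝ (Fin n) =>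
      ENNReal.ofReal (Real.exp (-‖x‖ ^ 2 / 2)) := by fun_prop
  have hint : Integrable fun x : EuclideanSpace ℝ (Fin n) => Real.exp (-‖x‖ ^ 2 / 2) := by
    have := (GaussianFourier.integrable_cexp_neg_mul_sq_norm_add (V := EuclideanSpace ℝ (Fin n))
      hb 0 0).norm
    refine this.congr (ae_of_all _ fun x => ?_)
    simp only [Complex.norm_exp, zero_mul, add_zero]
    congr 1
    have : (-(1 / 2) * (‖x‖ : ℂ) ^ 2) = ((-‖x‖ ^ 2 / 2 : ℝ) : ℂ) := by push_cast; ring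
    rw [this, Complex.ofReal_re]
  have hfin : IsFiniteMeasure ((volume : Measure (EuclideanSpace ℝ (Fin n))).withDensity
      fun x => ENNReal.ofReal (Real.exp (-‖x‖ ^ 2 / 2))) :=
    isFiniteMeasure_withDensity_ofReal hint.2
  refine ⟨ENNReal.ofReal p⁻¹, ?_⟩
  have hfin' := Measure.smul_finite (volume.withDensity fun x : EuclideanSpace ℝ (Fin n) =>
    ENNReal.ofReal (Real.exp (-‖x‖ ^ 2 / 2))) (ENNReal.ofReal_ne_top (r := p⁻¹))
  -- The density is identified through its Fourier transform. Only the existence of the constant is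
  -- used later.
  apply Measure.ext_of_charFun
  ext t
  rw [charFun_stdGaussian, charFun_apply, integral_smul_measure,
    integral_withDensity_eq_integral_toReal_smul hfm (ae_of_all _ fun x => ENNReal.ofReal_lt_top)]
  have h1 : ∀ x : EuclideanSpace ℝ (Fin n),
      (ENNReal.ofReal (Real.exp (-‖x‖ ^ 2 / 2))).toReal • Complex.exp (⟪x, t⟫ * Complex.I) =
      Complex.exp (-(1 / 2) * ‖x‖ ^ 2 + Complex.I * ⟪t, x⟫) := by
    intro x
    rw [ENNReal.toReal_ofReal (Real.exp_pos _).le, Complex.real_smul, Complex.ofReal_exp,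
      ← Complex.exp_add, real_inner_comm]
    congr 1
    push_cast
    ring
  simp_rw [h1]
  rw [GaussianFourier.integral_cexp_neg_mul_sq_norm_add hb, finrank_euclideanSpace_fin, hcp,
    ENNReal.toReal_ofReal (by positivity), Complex.real_smul, ← mul_assoc, ← Complex.ofReal_mul,
    inv_mul_cancel₀ hp0.ne', Complex.I_sq]
  push_cast
  rw [one_mul]
  congr 1
  ring

/-- Chebyshev's inequality with second moment `n`; this polynomial tail suffices because `Q`
dominates a large power of `n/δ`. -/
lemma stdGaussian_norm_gt_le (n : ℕ) {M : ℝ} (hM : 0 < M) :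
    stdGaussian (EuclideanSpace ℝ (Fin n)) {x | M < ‖x‖} ≤ ENNReal.ofReal (n / M ^ 2) := by
  have h1 : ∫⁻ x, ENNReal.ofReal (‖x‖ ^ 2) ∂(stdGaussian (EuclideanSpace ℝ (Fin n))) = n := by
    have h2 : ∀ i : Fin n, ∫⁻ x : EuclideanSpace ℝ (Fin n), ENNReal.ofReal (x i ^ 2)
        ∂(stdGaussian (EuclideanSpace ℝ (Fin n))) = 1 := by
      intro i
      have hmp := measurePreserving_eval_multivariateGaussian (μ := (0 : EuclideanSpace ℝ (Fin n)))
        (S := 1) Matrix.PosSemidef.one (i := i)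
      rw [multivariateGaussian_zero_one] at hmp
      rw [hmp.lintegral_comp (f := fun y => ENNReal.ofReal (y ^ 2)) (by fun_prop)]
      simp only [PiLp.zero_apply, one_apply_eq, Real.toNNReal_one]
      have h3 := evariance_eq_lintegral_ofReal id (gaussianReal 0 1)
      have h4 : MemLp id 2 (gaussianReal 0 1) := memLp_id_gaussianReal 2
      rw [← h4.ofReal_variance_eq, variance_id_gaussianReal] at h3
      simpa using h3.symm
    simp_rw [EuclideanSpace.real_norm_sq_eq]
    simp_rw [fun x : EuclideanSpace ℝ (Fin n) =>
      ENNReal.ofReal_sum_of_nonneg (s := Finset.univ) (f := fun i => x i ^ 2)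
        fun i _ => sq_nonneg _]
    rw [lintegral_finsetSum _ fun i _ => by fun_prop]
    simp [h2]
  have hM2 : ENNReal.ofReal (M ^ 2) ≠ 0 := by
    rw [Ne, ENNReal.ofReal_eq_zero, not_le]; positivity
  have h2 := meas_ge_le_lintegral_div (μ := stdGaussian (EuclideanSpace ℝ (Fin n)))
    (f := fun x => ENNReal.ofReal (‖x‖ ^ 2)) (by fun_prop) hM2 ENNReal.ofReal_ne_top
  rw [h1] at h2
  refine (measure_mono fun x hx => ?_).trans (h2.trans_eq ?_)
  · exact ENNReal.ofReal_le_ofReal (pow_le_pow_left₀ hM.le (le_of_lt hx) 2)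
  · rw [ENNReal.ofReal_div_of_pos (by positivity), ENNReal.ofReal_natCast]

/-- Expand in an eigenbasis of `TᵀT`; all its eigenvalues are at least the square of the last
singular value. -/
lemma singularValue_mul_norm_le (S : Matrix (Fin n) (Fin n) ℝ) (x : EuclideanSpace ℝ (Fin n)) :
    singularValue S (n - 1) * ‖x‖ ≤ ‖sketch S x‖ := by
  set T := Matrix.toEuclideanLin S with hT
  have hn : Module.finrank ℝ (EuclideanSpace ℝ (Fin n)) = n := finrank_euclideanSpace_fin
  set b := T.isSymmetric_adjoint_comp_self.eigenvectorBasis hn with hb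
  have h0 : 0 ≤ singularValue S (n - 1) := T.singularValues_nonneg _
  have h1 : ‖sketch S x‖ ^ 2 = ∑ i : Fin n, T.singularValues i ^ 2 * (b.repr x i) ^ 2 := by
    have h2 : ‖sketch S x‖ ^ 2 = ⟪x, (LinearMap.adjoint T ∘ₗ T) x⟫ := by
      rw [LinearMap.comp_apply, LinearMap.adjoint_inner_right, real_inner_self_eq_norm_sq]
      rfl
    rw [h2, ← b.repr.inner_map_map, PiLp.inner_apply]
    refine Finset.sum_congr rfl fun i _ => ?_
    rw [hb, LinearMap.IsSymmetric.eigenvectorBasis_apply_self_apply, T.sq_singularValues_fin hn]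
    simp
    ring
  have h3 : ‖x‖ ^ 2 = ∑ i : Fin n, (b.repr x i) ^ 2 := by
    rw [← b.repr.norm_map, EuclideanSpace.real_norm_sq_eq]
  rw [← sq_le_sq₀ (mul_nonneg h0 (norm_nonneg _)) (norm_nonneg _), mul_pow, h1, h3, Finset.mul_sum]
  refine Finset.sum_le_sum fun i _ => mul_le_mul_of_nonneg_right ?_ (sq_nonneg _)
  exact pow_le_pow_left₀ h0 (T.singularValues_antitone (by omega)) 2

/-- Whitening: in suitable coordinates both Gaussians have weight `exp (-‖H x‖² / 2)`. -/
lemma exists_whitening {κ : ℝ} (hκ : 0 < κ) {S : Matrix (Fin n) (Fin n) ℝ}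
    (hS : (Sᵀ * S).det ≠ 0) :
    ∃ H : EuclideanSpace ℝ (Fin n) →ₗ[ℝ] EuclideanSpace ℝ (Fin n),
      Function.Injective H ∧
      (∀ x, singularValue S (n - 1) * ‖H x‖ ≤ √(2 * κ) * ‖x‖) ∧
      (∀ z, ENNReal.ofReal (gaussianWeight κ (Sᵀ * S) z) = normWeight H (intVec z)) ∧
      (∃ c : ENNReal, continuousGaussian κ (Sᵀ * S) = c • volume.withDensity (normWeight H)) ∧
      ∀ M, 0 < M → continuousGaussian κ (Sᵀ * S) {x | M < ‖H x‖} ≤ ENNReal.ofReal (n / M ^ 2) := by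
  set Sig := Sᵀ * S with hSig
  set V := (2 * κ)⁻¹ • Sig with hV
  have hSpos : Sig.PosSemidef := by
    have := Matrix.posSemidef_conjTranspose_mul_self S
    rwa [Matrix.conjTranspose_eq_transpose_of_trivial] at this
  have hVpos : V.PosSemidef := hSpos.smul (by positivity)
  -- The symmetric square root of the covariance pushes the standard Gaussian to the required one,
  -- so its inverse serves as `H`.
  set R := CFC.sqrt V with hR
  have hRR : R * R = V := CFC.sqrt_mul_sqrt_self _ hVpos.nonneg
  have hRt : Rᵀ = R := by
    have := (CFC.sqrt_nonneg V).isSelfAdjoint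
    rw [← Matrix.conjTranspose_eq_transpose_of_trivial]
    exact this
  have hVdet : V.det ≠ 0 := by
    rw [hV, Matrix.det_smul]
    exact mul_ne_zero (pow_ne_zero _ (by positivity)) hS
  have hRdet : IsUnit R.det := by
    rw [isUnit_iff_ne_zero]
    intro h
    apply hVdet
    rw [← hRR, Matrix.det_mul, h, zero_mul]
  have hRinv : R⁻¹ * R = 1 := Matrix.nonsing_inv_mul _ hRdet
  have hRinv' : R * R⁻¹ = 1 := Matrix.mul_nonsing_inv _ hRdet
  have hSdet : IsUnit Sig.det := isUnit_iff_ne_zero.2 hS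
  set H := Matrix.toEuclideanLin R⁻¹ with hH
  have hHx : ∀ x, H x = sketch R⁻¹ x := fun _ => rfl
  have hHR : ∀ x, H (sketch R x) = x := fun x => by rw [hHx, ← sketch_mul, hRinv, sketch_one]
  have hRH : ∀ x, sketch R (H x) = x := fun x => by rw [hHx, ← sketch_mul, hRinv', sketch_one]
  have hnorm : ∀ x, ‖H x‖ ^ 2 = 2 * κ * (x.ofLp ⬝ᵥ (Sig⁻¹ *ᵥ x.ofLp)) := by
    intro x
    have h1 : ‖H x‖ ^ 2 = (R⁻¹ *ᵥ x.ofLp) ⬝ᵥ (R⁻¹ *ᵥ x.ofLp) := by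
      rw [← real_inner_self_eq_norm_sq, EuclideanSpace.inner_eq_star_dotProduct]
      simp [H, Matrix.toLpLin_apply]
    have h2 : R⁻¹ * R⁻¹ = (2 * κ) • Sig⁻¹ := by
      rw [← Matrix.mul_inv_rev, hRR]
      apply Matrix.inv_eq_left_inv
      rw [hV, Matrix.smul_mul, Matrix.mul_smul, smul_smul, Matrix.nonsing_inv_mul _ hSdet,
        mul_inv_cancel₀ (by positivity), one_smul]
    have h3 : (R⁻¹)ᵀ = R⁻¹ := by rw [Matrix.transpose_nonsing_inv, hRt]
    rw [h1, Matrix.dotProduct_mulVec, ← Matrix.mulVec_transpose, h3, Matrix.mulVec_mulVec, h2,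
      Matrix.smul_mulVec, smul_dotProduct, smul_eq_mul, dotProduct_comm]
  have hcg : continuousGaussian κ Sig =
      (stdGaussian (EuclideanSpace ℝ (Fin n))).map (sketch R) := by
    rw [continuousGaussian, multivariateGaussian]
    congr 1
    ext x i
    simp [sketch, Matrix.toLpLin_apply, R, V]
  have hRm := measurable_sketch R
  have hHm : Measurable H := measurable_sketch R⁻¹
  refine ⟨H, fun x y hxy => by rw [← hRH x, hxy, hRH], ?_, ?_, ?_, ?_⟩
  · intro x
    -- With `y = Σ⁻¹x` one has `‖H x‖ = √(2κ) ‖S y‖` and `‖S y‖² = x · y ≤ ‖x‖ ‖y‖`; the smallest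
    -- singular value then bounds `‖y‖` by `‖S y‖`.
    set y : EuclideanSpace ℝ (Fin n) := WithLp.toLp 2 (Sig⁻¹ *ᵥ x.ofLp) with hy
    have hxy : Sig *ᵥ y.ofLp = x.ofLp := by
      rw [hy, Matrix.mulVec_mulVec, Matrix.mul_nonsing_inv _ hSdet, Matrix.one_mulVec]
    have h1 : x.ofLp ⬝ᵥ y.ofLp = ‖sketch S y‖ ^ 2 := by
      rw [← real_inner_self_eq_norm_sq, EuclideanSpace.inner_eq_star_dotProduct]
      simp only [sketch, Matrix.toLpLin_apply, star_trivial]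
      rw [Matrix.dotProduct_mulVec (S *ᵥ y.ofLp) S, ← Matrix.mulVec_transpose,
        Matrix.mulVec_mulVec, hxy]
    have h2 : x.ofLp ⬝ᵥ y.ofLp ≤ ‖x‖ * ‖y‖ := by
      have := real_inner_le_norm y x
      rw [EuclideanSpace.inner_eq_star_dotProduct, star_trivial] at this
      linarith
    have h3 := singularValue_mul_norm_le S y
    set σ := singularValue S (n - 1)
    have hσ : 0 ≤ σ := (Matrix.toEuclideanLin S).singularValues_nonneg _
    have h4 : σ * ‖sketch S y‖ ≤ ‖x‖ := by
      rcases (norm_nonneg (sketch S y)).eq_or_lt with h | h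
      · rw [← h, mul_zero]; exact norm_nonneg _
      · have h5 : σ * ‖sketch S y‖ ^ 2 ≤ ‖x‖ * ‖sketch S y‖ := by
          calc σ * ‖sketch S y‖ ^ 2 ≤ σ * (‖x‖ * ‖y‖) := by
                rw [← h1]; exact mul_le_mul_of_nonneg_left h2 hσ
            _ = ‖x‖ * (σ * ‖y‖) := by ring
            _ ≤ _ := mul_le_mul_of_nonneg_left h3 (norm_nonneg _)
        nlinarith
    have h6 : ‖H x‖ = √(2 * κ) * ‖sketch S y‖ := by
      rw [← sq_eq_sq₀ (norm_nonneg _) (by positivity), hnorm, mul_pow,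
        Real.sq_sqrt (by positivity), ← h1]
    rw [h6, mul_left_comm]
    exact mul_le_mul_of_nonneg_left h4 (Real.sqrt_nonneg _)
  · intro z
    rw [normWeight, hnorm, gaussianWeight]
    congr 2
    simp only [intVec]
    ring
  · obtain ⟨c, hc⟩ := exists_stdGaussian_eq_smul_withDensity n
    have hdet : LinearMap.det (Matrix.toEuclideanLin R) ≠ 0 := by
      intro h0
      have := LinearMap.bot_lt_ker_of_det_eq_zero h0
      apply this.ne'
      rw [LinearMap.ker_eq_bot]
      intro x y hxy
      rw [← hHR x, ← hHR y]
      exact congrArg H hxy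
    have hmap := Measure.map_linearMap_addHaar_eq_smul_addHaar
      (volume : Measure (EuclideanSpace ℝ (Fin n))) hdet
    refine ⟨c * ENNReal.ofReal |(LinearMap.det (Matrix.toEuclideanLin R))⁻¹|, ?_⟩
    ext D hD
    have hf : Measurable (D.indicator (normWeight H)) := measurable_normWeight.indicator hD
    rw [hcg, hc, Measure.map_apply hRm hD, Measure.smul_apply, Measure.smul_apply,
      withDensity_apply _ (hRm hD), withDensity_apply _ hD, ← lintegral_indicator (hRm hD),
      ← lintegral_indicator hD]
    have h1 : ∀ x, (sketch R ⁻¹' D).indicator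
        (fun x => ENNReal.ofReal (Real.exp (-‖x‖ ^ 2 / 2))) x =
        D.indicator (normWeight H) (sketch R x) := by
      intro x
      by_cases hx : sketch R x ∈ D
      · rw [Set.indicator_of_mem (by exact hx), Set.indicator_of_mem hx, normWeight, hHR]
      · rw [Set.indicator_of_notMem (by exact hx), Set.indicator_of_notMem hx]
    have h2 : ∫⁻ x, D.indicator (normWeight H) (sketch R x) =
        ENNReal.ofReal |(LinearMap.det (Matrix.toEuclideanLin R))⁻¹| *
          ∫⁻ x, D.indicator (normWeight H) x := by
      rw [← lintegral_map hf hRm]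
      have : Measure.map (sketch R) volume = Measure.map (Matrix.toEuclideanLin R) volume := rfl
      rw [this, hmap, lintegral_smul_measure, smul_eq_mul]
    simp_rw [h1]
    rw [h2, smul_eq_mul, smul_eq_mul, mul_assoc]
  · intro M hM
    rw [hcg, Measure.map_apply hRm (measurableSet_lt measurable_const hHm.norm)]
    refine le_trans (measure_mono fun x hx => ?_) (stdGaussian_norm_gt_le n hM)
    simpa [hHR] using hx

end LinearSketch

/-! ### The rounded continuous Gaussian against the discrete one. -/

namespace LinearSketch

variable {n l r : ℕ}

lemma discreteGaussian_apply (κ : ℝ) (Sig : Matrix (Fin n) (Fin n) ℝ) (U : Set (Fin n → ℤ)) :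
    discreteGaussian κ Sig U = (∑' y, ENNReal.ofReal (gaussianWeight κ Sig y))⁻¹ *
      ∑' z, U.indicator (fun z => ENNReal.ofReal (gaussianWeight κ Sig z)) z := by
  rw [discreteGaussian, Measure.smul_apply, withDensity_apply _ (MeasurableSet.of_discrete),
    ← lintegral_indicator MeasurableSet.of_discrete, lintegral_count, smul_eq_mul]

lemma linearIndependent_intVec {k : ℕ} {v : Fin k → Fin n → ℤ} (hv : LinearIndependent ℤ v) :
    LinearIndependent ℝ fun i => intVec (v i) := by
  have h := (linearIndependent_algebraMap_comp_iff (R := ℤ) (S := ℝ)).2 hv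
  exact h.map' (WithLp.linearEquiv 2 ℝ (Fin n → ℝ)).symm.toLinearMap (LinearEquiv.ker _)

/-- This lets a statement about the real sketch `A` of integer points be read off the integer sketch
`At`, and conversely. -/
lemma sketch_intVec_eq_iff {A : Matrix (Fin l) (Fin n) ℝ} {At : Matrix (Fin r) (Fin n) ℤ}
    (h : rowSpan A = rowSpan (toReal At)) {x y : Fin n → ℤ} :
    sketch A (intVec x) = sketch A (intVec y) ↔ At *ᵥ x = At *ᵥ y := by
  obtain ⟨C, hC⟩ := exists_eq_mul_of_rowSpan_le h.ge
  obtain ⟨D, hD⟩ := exists_eq_mul_of_rowSpan_le h.le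
  rw [← intVec_injective.eq_iff, ← sketch_toReal_intVec, ← sketch_toReal_intVec]
  constructor
  · intro h1; rw [hC, sketch_mul, sketch_mul, h1]
  · intro h1; rw [hD, sketch_mul, sketch_mul, h1]

/-- The numerical estimates behind the comparison of the two Gaussians. -/
lemma exists_comparison_parameters {δ Q κ σ : ℝ} (hn : 0 < n) (hδ0 : 0 < δ) (hδ : δ < 1 / 10)
    (hQ : (2 * n / δ) ^ 30 ≤ Q) (hκ0 : 0 < κ) (hκ : κ ≤ 7 / 2) (hσ : n * Q * Real.log Q ≤ σ) :
    0 < σ ∧ ∃ a q M : ℝ, Real.exp (-(2 * Real.pi ^ 2 / a)) ≤ q ∧ q ≤ 1 / 8 ∧ 0 ≤ q ∧ 0 < M ∧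
      n / M ^ 2 ≤ δ / 9 ∧ (√(2 * κ) / σ * (Q * √n)) ^ 2 ≤ a ∧ (√(2 * κ) / σ) ^ 2 ≤ a ∧
      (1 + 16 * q) ^ n * (1 + 16 * q) ^ n *
        Real.exp (M * (√(2 * κ) / σ * √n) + (√(2 * κ) / σ * √n) ^ 2 / 2) ≤ 1 + 2 * δ / 9 := by
  have hn1 : (1 : ℝ) ≤ n := by exact_mod_cast hn
  set t : ℝ := 2 * n / δ with ht
  have ht20 : 20 * n ≤ t := by
    rw [ht, le_div_iff₀ hδ0]; nlinarith
  have ht20' : 20 ≤ t := by linarith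
  have htQ : t ^ 4 ≤ Q := (pow_le_pow_right₀ (by linarith) (by norm_num)).trans hQ
  have ht3 : (8000 : ℝ) ≤ t ^ 3 := by
    calc (8000 : ℝ) = 20 ^ 3 := by norm_num
      _ ≤ t ^ 3 := pow_le_pow_left₀ (by norm_num) ht20' 3
  have htQ' : t * 8000 ≤ Q := by nlinarith
  have hQ0 : 0 < Q := by linarith
  have hQ1 : 1 ≤ Q := by linarith
  have hlog : 1 ≤ Real.log Q := by
    rw [Real.le_log_iff_exp_le hQ0]
    have := Real.exp_one_lt_d9
    linarith
  set L := Real.log Q with hL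
  have hσ1 : n * Q * L > 0 := by positivity
  have hσ0 : 0 < σ := by linarith
  -- Here `7 ≥ 2κ` covers both normalizations, and `a = 7/L²` bounds the squared whitened length of
  -- the kernel vectors. As `2π² ≥ 14` and `L ≥ 1`, the dual terms are at most `exp (-2L) = Q⁻²`.
  -- The choice of `M` makes the tail `n/M²` equal to `δ/9`.
  refine ⟨hσ0, 7 / L ^ 2, (Q ^ 2)⁻¹, √(9 * n / δ), ?_, ?_, by positivity, by positivity, ?_, ?_,
    ?_, ?_⟩
  · have h1 : (Q ^ 2)⁻¹ = Real.exp (-(2 * L)) := by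
      rw [Real.exp_neg, two_mul, Real.exp_add, hL, Real.exp_log hQ0, sq]
    rw [h1, Real.exp_le_exp, neg_le_neg_iff, div_div_eq_mul_div, le_div_iff₀ (by norm_num)]
    have hpi := Real.pi_gt_three
    have : 9 ≤ Real.pi ^ 2 := by nlinarith
    nlinarith [mul_le_mul_of_nonneg_right this (sq_nonneg L)]
  · rw [inv_le_comm₀ (by positivity) (by norm_num)]
    nlinarith
  · rw [Real.sq_sqrt (by positivity)]
    apply le_of_eq
    field_simp
  all_goals
    have hk7 : √(2 * κ) ^ 2 ≤ 7 := by rw [Real.sq_sqrt (by positivity)]; linarith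
    have hn2 : √(n : ℝ) ^ 2 = n := Real.sq_sqrt (by positivity)
  · have h2 : (√(2 * κ) / σ * (Q * √n)) ^ 2 = √(2 * κ) ^ 2 * (Q ^ 2 * n) / σ ^ 2 := by
      rw [mul_pow, mul_pow, hn2, div_pow]; ring
    rw [h2, div_le_div_iff₀ (by positivity) (by positivity)]
    have h3 : (n * Q * L) ^ 2 ≤ σ ^ 2 := pow_le_pow_left₀ hσ1.le hσ 2
    calc √(2 * κ) ^ 2 * (Q ^ 2 * n) * L ^ 2 ≤ 7 * (Q ^ 2 * n) * L ^ 2 := by gcongr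
      _ ≤ 7 * (Q ^ 2 * (n * n)) * L ^ 2 := by gcongr; nlinarith
      _ = 7 * (n * Q * L) ^ 2 := by ring
      _ ≤ _ := by gcongr
  · rw [div_pow, div_le_div_iff₀ (by positivity) (by positivity)]
    have h3 : L ≤ σ := by
      refine le_trans ?_ hσ
      have : 1 ≤ n * Q := by nlinarith
      nlinarith
    gcongr
  · set u := √(2 * κ) / σ * √n with hu
    have hu0 : 0 ≤ u := by positivity
    have huQ : u ≤ 3 / Q := by
      rw [← sq_le_sq₀ hu0 (by positivity)]
      have h2 : u ^ 2 = √(2 * κ) ^ 2 * n / σ ^ 2 := by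
        rw [hu, mul_pow, hn2, div_pow]; ring
      rw [h2, div_pow, div_le_div_iff₀ (by positivity) (by positivity)]
      have h3 : (n * Q) ^ 2 ≤ σ ^ 2 := by
        refine pow_le_pow_left₀ (by positivity) (le_trans ?_ hσ) 2
        have : 0 < n * Q := by positivity
        nlinarith
      calc √(2 * κ) ^ 2 * n * Q ^ 2 ≤ 7 * n * Q ^ 2 := by gcongr
        _ ≤ 9 * (n * n) * Q ^ 2 := by gcongr ?_ * _; nlinarith
        _ = 3 ^ 2 * (n * Q) ^ 2 := by ring
        _ ≤ _ := by gcongr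
    set M := √(9 * n / δ) with hM
    have hMt : M ≤ t := by
      rw [hM, Real.sqrt_le_left (by linarith)]
      have : 9 * n / δ = 9 / 2 * t := by rw [ht]; ring
      rw [this]
      nlinarith
    have hM0 : 0 ≤ M := Real.sqrt_nonneg _
    have hu1 : u ≤ 1 := huQ.trans (by rw [div_le_one hQ0]; linarith)
    have hpow : (1 + 16 * (Q ^ 2)⁻¹) ^ n * (1 + 16 * (Q ^ 2)⁻¹) ^ n ≤ Real.exp (32 / Q) := by
      have h4 : (1 + 16 * (Q ^ 2)⁻¹) ^ n ≤ Real.exp (16 / Q) := by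
        calc (1 + 16 * (Q ^ 2)⁻¹) ^ n ≤ Real.exp (16 * (Q ^ 2)⁻¹) ^ n := by
              gcongr; rw [add_comm]; exact Real.add_one_le_exp _
          _ = Real.exp (n * (16 * (Q ^ 2)⁻¹)) := (Real.exp_nat_mul _ _).symm
          _ ≤ Real.exp (16 / Q) := by
              rw [Real.exp_le_exp]
              have : n * (16 * (Q ^ 2)⁻¹) = 16 / Q * (n / Q) := by field_simp
              rw [this]
              apply mul_le_of_le_one_right (by positivity)
              rw [div_le_one hQ0]; linarith
      calc _ ≤ Real.exp (16 / Q) * Real.exp (16 / Q) := by gcongr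
        _ = _ := by rw [← Real.exp_add]; congr 1; ring
    have hexp : M * u + u ^ 2 / 2 ≤ (3 * t + 3) / Q := by
      have h5 : M * u ≤ t * (3 / Q) := mul_le_mul hMt huQ hu0 (by linarith)
      have h6 : u ^ 2 ≤ u := by nlinarith
      have h7 : (3 * t + 3) / Q = t * (3 / Q) + 3 / Q := by ring
      rw [h7]; linarith
    -- All exponents together are at most `5t/Q`, which is below `δ/100` because `δ t = 2n` and `t⁴
    -- ≤ Q`.
    set η := 5 * t / Q with hη
    have hη1 : 32 / Q + (3 * t + 3) / Q ≤ η := by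
      rw [hη, ← add_div]
      gcongr
      linarith
    have hη0 : 0 ≤ η := by positivity
    have hηδ : η ≤ δ / 100 := by
      have h8 : δ * t = 2 * n := by rw [ht]; field_simp
      rw [hη, div_le_div_iff₀ hQ0 (by norm_num)]
      calc 5 * t * 100 ≤ 2 * (400 * t) := by linarith
        _ ≤ 2 * n * (t * t * t) := by
          have : 400 * t ≤ t * t * t :=
            mul_le_mul_of_nonneg_right (by nlinarith only [ht20']) (by linarith)
          have h9 : 0 ≤ t * t * t := by positivity
          calc 2 * (400 * t) ≤ 2 * 1 * (t * t * t) := by linarith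
            _ ≤ _ := by gcongr
        _ = δ * t ^ 4 := by rw [← h8]; ring
        _ ≤ δ * Q := by gcongr
    calc _ ≤ Real.exp (32 / Q) * Real.exp ((3 * t + 3) / Q) := by gcongr
      _ ≤ Real.exp η := by rw [← Real.exp_add]; exact Real.exp_le_exp.2 hη1
      _ ≤ 1 + 2 * η := by
        have := Real.abs_exp_sub_one_le (x := η) (by rw [abs_of_nonneg hη0]; linarith)
        rw [abs_of_nonneg hη0] at this
        linarith [le_abs_self (Real.exp η - 1)]
      _ ≤ _ := by linarith

/-- Up to a small error, the rounded sketch of a continuous Gaussian is no more likely to fall into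
a given set than the sketch of the discrete Gaussian. -/
lemma continuousGaussian_rounding_le {δ Q κ : ℝ} (hδ0 : 0 < δ) (hδ : δ < 1 / 10)
    (hQ : (2 * n / δ) ^ 30 ≤ Q) (hκ : κ = 1 / 2 ∨ κ = Real.pi) {S : Matrix (Fin n) (Fin n) ℝ}
    (hS : (Sᵀ * S).det ≠ 0) (hσ : n * Q * Real.log Q ≤ singularValue S (n - 1))
    {A : Matrix (Fin l) (Fin n) ℝ} {At : Matrix (Fin l) (Fin n) ℤ} (hA : RowOrthonormal A)
    (hspan : rowSpan A = rowSpan (toReal At)) {v : Fin (n - l) → Fin n → ℤ}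
    (hv : LinearIndependent ℤ v) (hv0 : ∀ i, At *ᵥ v i = 0) (hvn : ∀ i, ‖intVec (v i)‖ ≤ Q * √n)
    {ζ : EuclideanSpace ℝ (Fin l) → Fin n → ℤ} (hζ : Measurable ζ)
    (hζd : ∀ w, ‖w - sketch A (intVec (ζ w))‖ ≤ √n)
    (hζA : ∀ z w, At *ᵥ ζ (sketch A (intVec z) + w) = At *ᵥ (z + ζ w))
    [IsProbabilityMeasure (discreteGaussian κ (Sᵀ * S))] (W : Set (Fin l → ℤ)) :
    continuousGaussian κ (Sᵀ * S) {x | At *ᵥ ζ (sketch A x) ∈ W} ≤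
      discreteGaussian κ (Sᵀ * S) {z | At *ᵥ z ∈ W} + ENNReal.ofReal (δ / 3) := by
  have hγ : IsProbabilityMeasure (continuousGaussian κ (Sᵀ * S)) := by
    unfold continuousGaussian; infer_instance
  set U : Set (Fin n → ℤ) := {z | At *ᵥ z ∈ W} with hUdef
  -- The parameters need `n ≥ 1`; for `n = 0` there is only one integer point.
  rcases Nat.eq_zero_or_pos n with rfl | hn
  · by_cases h0 : At *ᵥ (0 : Fin 0 → ℤ) ∈ W
    · have : U = Set.univ := by
        ext z; simpa [hUdef, Subsingleton.elim z 0] using h0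
      rw [this, measure_univ]
      exact prob_le_one.trans le_self_add
    · have : {x | At *ᵥ ζ (sketch A x) ∈ W} = ∅ := by
        ext x; simpa [Subsingleton.elim (ζ (sketch A x)) 0] using h0
      rw [this, measure_empty]
      exact zero_le
  have hκ0 : 0 < κ := by rcases hκ with h | h <;> rw [h]; norm_num; exact Real.pi_pos
  have hκ7 : κ ≤ 7 / 2 := by
    rcases hκ with h | h <;> rw [h]; norm_num
    have := Real.pi_lt_d2; linarith
  obtain ⟨hσ0, a, q, M, haq, hq8, hq0, hM0, hMn, hav, hae, hnum⟩ :=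
    exists_comparison_parameters hn hδ0 hδ hQ hκ0 hκ7 hσ
  obtain ⟨H, hHi, hHσ, hHw, ⟨c, hc⟩, htail⟩ := exists_whitening hκ0 hS
  set σ := singularValue S (n - 1) with hσdef
  set s := √(2 * κ) / σ with hs
  have hs0 : 0 ≤ s := by positivity
  have hHs : ∀ x, ‖H x‖ ≤ s * ‖x‖ := by
    intro x
    rw [hs, div_mul_eq_mul_div, le_div_iff₀ hσ0, mul_comm]
    exact hHσ x
  have hvA : ∀ i, sketch A (intVec (v i)) = 0 := by
    intro i
    have h1 : sketch A (intVec (v i)) = sketch A (intVec 0) :=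
      (sketch_intVec_eq_iff hspan).2 (by rw [hv0, Matrix.mulVec_zero])
    rw [h1, intVec_zero]
    exact map_zero (Matrix.toEuclideanLin A)
  have hvR := linearIndependent_intVec hv
  have hsum : ∀ m : Fin (n - l) → ℤ, At *ᵥ (∑ i, m i • v i) = 0 := by
    intro m
    rw [Matrix.mulVec_sum]
    exact Finset.sum_eq_zero fun i _ => by rw [Matrix.mulVec_smul, hv0, smul_zero]
  have hmain := setLIntegral_normWeight_le_tsum (H := H) (M := M) (U := U) haq hq8 hs0 hHi hHs hvR
    (fun i => (pow_le_pow_left₀ (norm_nonneg _)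
      ((hHs _).trans (mul_le_mul_of_nonneg_left (hvn i) hs0)) 2).trans hav)
    (exists_norm_le_norm_sketch hA hvR hvA) hζ hζd
    (fun z m => by simp only [hUdef, Set.mem_ofPred_eq, Matrix.mulVec_add, hsum, add_zero])
    (fun z w => by simp only [hUdef, Set.mem_ofPred_eq, hζA])
  have htot := tsum_normWeight_le_lintegral (H := H) haq hq8 hHi (fun i => by
    refine (pow_le_pow_left₀ (norm_nonneg _) (hHs _) 2).trans ?_
    simpa using hae)
  set Z : ENNReal := ∑' z : Fin n → ℤ, normWeight H (intVec z) with hZ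
  have hdisc : ∀ V : Set (Fin n → ℤ), discreteGaussian κ (Sᵀ * S) V =
      Z⁻¹ * ∑' z, V.indicator (fun z => normWeight H (intVec z)) z := by
    intro V; rw [discreteGaussian_apply]; simp_rw [hHw]; rfl
  have hZ1 : Z⁻¹ * Z = 1 := by
    have := hdisc Set.univ
    rw [measure_univ] at this
    simpa using this.symm
  have hcont : ∀ D, MeasurableSet D → continuousGaussian κ (Sᵀ * S) D =
      c * ∫⁻ x in D, normWeight H x := by
    intro D hD
    rw [hc, Measure.smul_apply, withDensity_apply _ hD, smul_eq_mul]
  have hc1 : c * ∫⁻ x, normWeight H x = 1 := by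
    have := hcont Set.univ MeasurableSet.univ
    rw [measure_univ] at this
    simpa using this.symm
  set D : Set (EuclideanSpace ℝ (Fin n)) := {x | ‖H x‖ ≤ M ∧ ζ (sketch A x) ∈ U} with hD
  have hHm : Measurable H := H.continuous_of_finiteDimensional.measurable
  have hDm : MeasurableSet D :=
    (measurableSet_le hHm.norm measurable_const).inter
      ((hζ.comp (measurable_sketch A)) (MeasurableSet.of_discrete (s := U)))
  set K := ENNReal.ofReal (1 + 16 * q) ^ (n - l) *
    ENNReal.ofReal (Real.exp (M * (s * √n) + (s * √n) ^ 2 / 2)) with hK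
  have hKn : ENNReal.ofReal (1 + 16 * q) ^ n * K ≤ ENNReal.ofReal (1 + 2 * δ / 9) := by
    have h1 : (1 : ENNReal) ≤ ENNReal.ofReal (1 + 16 * q) := by
      rw [ENNReal.one_le_ofReal]; linarith
    calc ENNReal.ofReal (1 + 16 * q) ^ n * K ≤ ENNReal.ofReal (1 + 16 * q) ^ n *
          (ENNReal.ofReal (1 + 16 * q) ^ n *
            ENNReal.ofReal (Real.exp (M * (s * √n) + (s * √n) ^ 2 / 2))) := by
          rw [hK]; gcongr
          exact Nat.sub_le _ _
      _ = ENNReal.ofReal ((1 + 16 * q) ^ n * (1 + 16 * q) ^ n *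
            Real.exp (M * (s * √n) + (s * √n) ^ 2 / 2)) := by
          rw [← ENNReal.ofReal_pow (by positivity), ← ENNReal.ofReal_mul (by positivity),
            ← ENNReal.ofReal_mul (by positivity), mul_assoc]
      _ ≤ _ := ENNReal.ofReal_le_ofReal hnum
  -- The unknown density constant `c` and the lattice mass `Z` are eliminated by `c ∫ = 1`, `Z⁻¹ Z =
  -- 1` and the comparison of `Z` with the integral.
  have hgood : continuousGaussian κ (Sᵀ * S) D ≤
      ENNReal.ofReal (1 + 2 * δ / 9) * discreteGaussian κ (Sᵀ * S) U := by
    set X := ∑' z, U.indicator (fun z => normWeight H (intVec z)) z with hX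
    calc continuousGaussian κ (Sᵀ * S) D = c * (∫⁻ x in D, normWeight H x) * (Z⁻¹ * Z) := by
          rw [hcont D hDm, hZ1, mul_one]
      _ ≤ c * (K * X) * (Z⁻¹ * (ENNReal.ofReal (1 + 16 * q) ^ n * ∫⁻ x, normWeight H x)) := by
          gcongr
      _ = (ENNReal.ofReal (1 + 16 * q) ^ n * K) * (Z⁻¹ * X) * (c * ∫⁻ x, normWeight H x) := by
          ring
      _ ≤ _ := by
          rw [hc1, mul_one, hdisc U]
          gcongr
  have hsub : {x | At *ᵥ ζ (sketch A x) ∈ W} ⊆ {x | M < ‖H x‖} ∪ D := by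
    intro x hx
    by_cases h : M < ‖H x‖
    · exact Or.inl h
    · exact Or.inr ⟨not_lt.1 h, hx⟩
  have hp1 : discreteGaussian κ (Sᵀ * S) U ≤ 1 := prob_le_one
  -- The tail costs `δ/9`, and the factor `1 + 2δ/9` on a probability costs `2δ/9` more.
  calc continuousGaussian κ (Sᵀ * S) {x | At *ᵥ ζ (sketch A x) ∈ W}
      ≤ continuousGaussian κ (Sᵀ * S) {x | M < ‖H x‖} + continuousGaussian κ (Sᵀ * S) D :=
        (measure_mono hsub).trans (measure_union_le _ _)
    _ ≤ ENNReal.ofReal (δ / 9) +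
        ENNReal.ofReal (1 + 2 * δ / 9) * discreteGaussian κ (Sᵀ * S) U := by
        gcongr
        exact (htail M hM0).trans (ENNReal.ofReal_le_ofReal hMn)
    _ = ENNReal.ofReal (δ / 9) + (discreteGaussian κ (Sᵀ * S) U +
        ENNReal.ofReal (2 * δ / 9) * discreteGaussian κ (Sᵀ * S) U) := by
        rw [ENNReal.ofReal_add zero_le_one (by positivity), ENNReal.ofReal_one, add_mul, one_mul]
    _ ≤ ENNReal.ofReal (δ / 9) + (discreteGaussian κ (Sᵀ * S) U +
        ENNReal.ofReal (2 * δ / 9) * 1) := by gcongr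
    _ = _ := by
        rw [mul_one, add_left_comm, ← ENNReal.ofReal_add (by positivity) (by positivity)]
        congr 2; ring

end LinearSketch

/-! ### Existence of a preprocessing, by Siegel's lemma. -/

namespace LinearSketch

variable {n r : ℕ}

lemma norm_intVec_le {Q : ℝ} (hQ : 0 ≤ Q) {z : Fin n → ℤ} (h : ∀ i, |(z i : ℝ)| ≤ Q) :
    ‖intVec z‖ ≤ Q * √n := by
  rw [EuclideanSpace.norm_eq, ← Real.sqrt_sq hQ, ← Real.sqrt_mul (sq_nonneg Q)]
  apply Real.sqrt_le_sqrt
  calc ∑ i, ‖intVec z i‖ ^ 2 ≤ ∑ i : Fin n, Q ^ 2 := Finset.sum_le_sum fun i _ =>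
        pow_le_pow_left₀ (norm_nonneg _) (h i) 2
    _ = Q ^ 2 * n := by simp [mul_comm]

/-- Siegel's lemma: a short nonzero integer kernel vector supported on four times as many
coordinates as there are equations. -/
lemma exists_kernel_vector_supported {Q : ℝ} (hQ : 1 ≤ Q) (hnQ : (n : ℝ) ≤ Q) (hr : 0 < r)
    (hrn : 4 * r ≤ n) {A₀ : Matrix (Fin r) (Fin n) ℤ} (hA₀ : ∀ i j, |(A₀ i j : ℝ)| ≤ Q)
    {K : Fin (4 * r) → Fin n} (hK : Function.Injective K) :
    ∃ t : Fin (4 * r) → ℤ, t ≠ 0 ∧ A₀ *ᵥ Function.extend K t 0 = 0 ∧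
      ‖intVec (Function.extend K t 0)‖ ≤ Q * √n := by
  let := @Matrix.seminormedAddCommGroup (Fin r) (Fin (4 * r)) ℤ
  obtain ⟨t, ht0, hAt, htn⟩ := Int.Matrix.exists_ne_zero_int_vec_norm_le
    (A₀.submatrix id K) (by simp; omega) (by simpa using hr)
  have hr0 : (0 : ℝ) < r := by exact_mod_cast hr
  -- With four unknowns per equation the Siegel exponent is `1/3`, and `4r · Q ≤ Q² ≤ Q³` gives
  -- entries at most `Q`.
  have hexp : ((Fintype.card (Fin r) : ℝ) / (Fintype.card (Fin (4 * r)) - Fintype.card (Fin r))) =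
      1 / 3 := by
    simp only [Fintype.card_fin]; push_cast; field_simp; norm_num
  rw [hexp] at htn
  have hAn : ‖A₀.submatrix id K‖ ≤ Q := by
    rw [Matrix.norm_le_iff (by linarith)]
    intro i j
    rw [Int.norm_eq_abs]
    exact hA₀ i (K j)
  have htQ : ‖t‖ ≤ Q := by
    refine htn.trans ?_
    have h1 : (Fintype.card (Fin (4 * r)) : ℝ) * max 1 ‖A₀.submatrix id K‖ ≤ Q ^ (3 : ℝ) := by
      have h2 : (Fintype.card (Fin (4 * r)) : ℝ) ≤ Q := by
        refine le_trans ?_ hnQ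
        rw [Fintype.card_fin]; exact_mod_cast hrn
      have h3 : Q ^ (3 : ℝ) = Q ^ 3 := by exact_mod_cast Real.rpow_natCast Q 3
      calc _ ≤ Q * Q := mul_le_mul h2 (max_le hQ hAn) (by positivity) (by linarith)
        _ ≤ Q * Q * Q := le_mul_of_one_le_right (by positivity) hQ
        _ = _ := by rw [h3]; ring
    calc _ ≤ (Q ^ (3 : ℝ)) ^ (1 / 3 : ℝ) := Real.rpow_le_rpow (by positivity) h1 (by norm_num)
      _ = Q := by rw [← Real.rpow_mul (by linarith)]; norm_num
  refine ⟨t, ht0, ?_, norm_intVec_le (by linarith) fun i => ?_⟩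
  · ext a
    rw [← hAt]
    refine (Fintype.sum_of_injective K hK _ _ (fun i hi => ?_) fun j => ?_).symm
    · rw [Function.extend_apply' _ _ _ (by simpa using hi)]; simp
    · rw [hK.extend_apply]; rfl
  · by_cases hi : ∃ j, K j = i
    · obtain ⟨j, rfl⟩ := hi
      rw [hK.extend_apply, ← Int.norm_eq_abs]
      exact (norm_le_pi_norm t j).trans htQ
    · rw [Function.extend_apply' _ _ _ hi]; simpa using by linarith

/-- An integer vector, viewed as a rational vector. -/
def ratVec (z : Fin n → ℤ) : Fin n → ℚ := fun i => z i

lemma linearIndependent_ratVec_iff {k : ℕ} {v : Fin k → Fin n → ℤ} :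
    LinearIndependent ℚ (fun i => ratVec (v i)) ↔ LinearIndependent ℤ v :=
  linearIndependent_algebraMap_comp_iff (R := ℤ) (S := ℚ)

/-- The short integer vectors in the kernel span a subspace of small codimension. -/
lemma le_finrank_span_kernel_vectors {Q : ℝ} (hQ : 1 ≤ Q) (hnQ : (n : ℝ) ≤ Q) (hr : 0 < r)
    (hrn : 4 * r ≤ n) {A₀ : Matrix (Fin r) (Fin n) ℤ} (hA₀ : ∀ i j, |(A₀ i j : ℝ)| ≤ Q) :
    n ≤ 4 * r + Module.finrank ℚ (Submodule.span ℚ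
      (ratVec '' {z : Fin n → ℤ | A₀ *ᵥ z = 0 ∧ ‖intVec z‖ ≤ Q * √n})) := by
  set V := Submodule.span ℚ (ratVec '' {z : Fin n → ℤ | A₀ *ᵥ z = 0 ∧ ‖intVec z‖ ≤ Q * √n}) with hV
  by_contra! hlt
  set e : Fin n → (Fin n → ℚ) ⧸ V := fun i => V.mkQ (Pi.single i 1) with he
  have hspan : Submodule.span ℚ (Set.range e) = ⊤ := by
    have h1 : Set.range e = V.mkQ '' Set.range fun i : Fin n => (Pi.single i 1 : Fin n → ℚ) := by
      rw [← Set.range_comp]; rfl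
    have h2 : Submodule.span ℚ (Set.range fun i : Fin n => (Pi.single i 1 : Fin n → ℚ)) = ⊤ := by
      rw [← (Pi.basisFun ℚ (Fin n)).span_eq]
      congr 2
      ext i : 1
      simp
    rw [h1, Submodule.span_image, h2, Submodule.map_top, Submodule.range_mkQ]
  -- If the codimension of `V` exceeded `4r`, some `4r` coordinate vectors would be independent
  -- modulo `V`. Siegel's lemma on these coordinates yields a nonzero element of `V` supported
  -- there, a contradiction.
  obtain ⟨b, hbe, hbs, hbi⟩ := exists_linearIndependent ℚ (Set.range e)
  have hbf : Finite b := (Set.finite_range e).subset hbe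
  have hft := Fintype.ofFinite b
  have hcard : Fintype.card b = n - Module.finrank ℚ V := by
    have h1 := finrank_span_eq_card hbi
    rw [Subtype.range_coe, hbs, hspan, finrank_top] at h1
    have h2 := V.finrank_quotient_add_finrank
    rw [Module.finrank_fin_fun] at h2
    exact Nat.eq_sub_of_add_eq ((congrArg (· + _) h1.symm).trans h2)
  obtain ⟨emb⟩ : Nonempty (Fin (4 * r) ↪ b) :=
    Function.Embedding.nonempty_of_card_le (by rw [Fintype.card_fin, hcard]; omega)
  have hKex : ∀ j, ∃ i, e i = (emb j : (Fin n → ℚ) ⧸ V) := fun j => hbe (emb j).2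
  choose K hK using hKex
  have hind : LinearIndependent ℚ fun j => e (K j) := by
    convert! hbi.comp emb emb.injective using 1
    ext1 j
    exact hK j
  have hKi : Function.Injective K := fun j j' h => hind.injective (by simp only [h])
  obtain ⟨t, ht0, hAt, htn⟩ := exists_kernel_vector_supported hQ hnQ hr hrn hA₀ hKi
  set z := Function.extend K t 0 with hz
  have hzV : ratVec z ∈ V := Submodule.subset_span ⟨z, ⟨hAt, htn⟩, rfl⟩
  have hzs : ratVec z = ∑ j, (t j : ℚ) • (Pi.single (K j) 1 : Fin n → ℚ) := by
    have h1 : ratVec z = ∑ i, (z i : ℚ) • (Pi.single i 1 : Fin n → ℚ) := by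
      ext i; simp [ratVec, Finset.sum_apply, Pi.single_apply]
    rw [h1]
    refine (Fintype.sum_of_injective K hKi _ _ (fun i hi => ?_) fun j => ?_).symm
    · rw [hz, Function.extend_apply' _ _ _ (by simpa using hi)]; simp
    · rw [hz, hKi.extend_apply]
  have h0 : ∑ j, (t j : ℚ) • e (K j) = 0 := by
    have h1 : V.mkQ (ratVec z) = 0 := by rwa [Submodule.mkQ_apply, Submodule.Quotient.mk_eq_zero]
    rw [hzs, map_sum] at h1
    simpa only [map_smul] using h1
  apply ht0
  ext j
  exact_mod_cast Fintype.linearIndependent_iff.1 hind _ h0 j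

lemma exists_integer_multiple (w : Fin n → ℚ) :
    ∃ (c : ℚ) (z : Fin n → ℤ), c ≠ 0 ∧ ratVec z = c • w := by
  obtain ⟨b, hb⟩ := IsLocalization.exist_integer_multiples_of_finite (nonZeroDivisors ℤ) w
  choose z hz using hb
  refine ⟨(b : ℤ), z, by exact_mod_cast nonZeroDivisors.coe_ne_zero b, ?_⟩
  ext i
  have := hz i
  simpa [ratVec] using this

/-- Every integer matrix has a preprocessing. -/
theorem exists_isPreprocessed {Q : ℝ} (hQ : 1 ≤ Q) (hnQ : (n : ℝ) ≤ Q) (hrn : 4 * r ≤ n)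
    {A₀ : Matrix (Fin r) (Fin n) ℤ} (hA₀ : ∀ i j, |(A₀ i j : ℝ)| ≤ Q) :
    ∃ (l : ℕ) (At : Matrix (Fin l) (Fin n) ℤ), IsPreprocessed Q A₀ At := by
  rcases Nat.eq_zero_or_pos r with rfl | hr
  · refine ⟨0, A₀, le_rfl, linearIndependent_empty_type, le_rfl, fun i => Pi.single i 1, ?_,
      fun i => ⟨Subsingleton.elim _ _, norm_intVec_le (by linarith) fun j => ?_⟩⟩
    · convert! (Pi.basisFun ℤ (Fin n)).linearIndependent using 1
      ext1 i
      simp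
    · by_cases h : j = i
      · subst h; simpa using hQ
      · simpa [Pi.single_eq_of_ne h] using by linarith
  have hdim := le_finrank_span_kernel_vectors hQ hnQ hr hrn hA₀
  set F : Set (Fin n → ℤ) := {z | A₀ *ᵥ z = 0 ∧ ‖intVec z‖ ≤ Q * √n} with hF
  obtain ⟨b, hbF, hbs, hbi⟩ := exists_linearIndependent ℚ (ratVec '' F)
  have hbf : Finite b := hbi.finite
  have hft := Fintype.ofFinite b
  set d := Fintype.card b with hd
  have hdV : Module.finrank ℚ (Submodule.span ℚ (ratVec '' F)) = d := by
    have h1 := finrank_span_eq_card hbi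
    rwa [Subtype.range_coe, hbs] at h1
  have hdn : d ≤ n := by
    rw [← hdV]
    simpa using Submodule.finrank_le (Submodule.span ℚ (ratVec '' F))
  rw [hdV] at hdim
  have hvex : ∀ x : b, ∃ z ∈ F, ratVec z = x := fun x => hbF x.2
  choose v' hv'F hv' using hvex
  set v : Fin d → Fin n → ℤ := fun i => v' ((Fintype.equivFin b).symm i) with hv
  have hvF : ∀ i, v i ∈ F := fun i => hv'F _
  have hvind : LinearIndependent ℚ fun i => ratVec (v i) := by
    convert! hbi.comp _ (Fintype.equivFin b).symm.injective using 1
    ext1 i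
    exact hv' _
  set Mv : Matrix (Fin d) (Fin n) ℚ := Matrix.of fun i => ratVec (v i) with hMv
  -- The orthogonal complement of the short kernel vectors contains the rows of `A₀` and has
  -- dimension `n - d ≤ 4r`. Clearing denominators in a rational basis of it gives the rows of `At`.
  set N := LinearMap.ker Mv.mulVecLin with hN
  have hNdim : Module.finrank ℚ N = n - d := by
    have h1 := LinearMap.finrank_range_add_finrank_ker Mv.mulVecLin
    have h2 : Mv.rank = d := by
      have := LinearIndependent.rank_matrix (M := Mv) hvind
      simpa using this
    rw [Module.finrank_fin_fun] at h1
    rw [Matrix.rank] at h2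
    rw [hN]
    omega
  set β := Module.finBasisOfFinrankEq ℚ N hNdim with hβ
  choose c w hc hw using fun i => exists_integer_multiple (β i : Fin n → ℚ)
  have hβind : LinearIndependent ℚ fun i => (β i : Fin n → ℚ) :=
    β.linearIndependent.map' N.subtype (Submodule.ker_subtype N)
  have hwind : LinearIndependent ℚ fun i => ratVec (w i) := by
    convert! hβind.units_smul fun i => Units.mk0 (c i) (hc i) using 1
    ext1 i
    exact hw i
  have hdot : ∀ (x y : Fin n → ℤ), ratVec x ⬝ᵥ ratVec y = ((x ⬝ᵥ y : ℤ) : ℚ) := by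
    intro x y; simp [ratVec, dotProduct]
  have hmemN : ∀ x : Fin n → ℚ, x ∈ N ↔ ∀ i, ratVec (v i) ⬝ᵥ x = 0 := by
    intro x
    rw [hN, LinearMap.mem_ker, Matrix.mulVecLin_apply, funext_iff]
    rfl
  refine ⟨n - d, Matrix.of w, by omega, ?_, ?_, fun i => v (i.cast (by omega)), ?_, fun i => ⟨?_, ?_⟩⟩
  · exact (linearIndependent_algebraMap_comp_iff (R := ℤ) (S := ℝ)).2
      (linearIndependent_ratVec_iff.1 hwind)
  · rw [rowSpan, Submodule.span_le]
    rintro _ ⟨a, rfl⟩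
    have haN : ratVec (fun j => A₀ a j) ∈ N := by
      rw [hmemN]
      intro i
      rw [dotProduct_comm, hdot]
      exact_mod_cast congrFun (hvF i).1 a
    have h1 := β.sum_repr ⟨_, haN⟩
    have h2 : ratVec (fun j => A₀ a j) = ∑ i, (β.repr ⟨_, haN⟩ i * (c i)⁻¹) • ratVec (w i) := by
      refine (congrArg Subtype.val h1).symm.trans ?_
      rw [AddSubmonoidClass.coe_finsetSum]
      refine Finset.sum_congr rfl fun i _ => ?_
      rw [hw, smul_smul, mul_assoc, inv_mul_cancel₀ (hc i), mul_one]
      rfl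
    refine (Submodule.mem_span_range_iff_exists_fun ℝ).2
      ⟨fun i => ((β.repr ⟨_, haN⟩ i * (c i)⁻¹ : ℚ) : ℝ), ?_⟩
    ext j
    have h4 := congrArg (Rat.cast (K := ℝ)) (congrFun h2 j)
    simp only [Finset.sum_apply, Pi.smul_apply, smul_eq_mul, ratVec] at h4
    push_cast at h4
    simp only [Finset.sum_apply, Pi.smul_apply, smul_eq_mul, toReal, Matrix.row, Matrix.map_apply,
      Matrix.of_apply]
    push_cast
    exact h4.symm
  · refine linearIndependent_ratVec_iff.1 ?_
    exact hvind.comp (Fin.cast (by omega : n - (n - d) = d)) (Fin.cast_injective _)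
  · ext j
    have h1 : (w j ⬝ᵥ v (i.cast (by omega)) : ℤ) = 0 := by
      have h2 := (hmemN (β j)).1 (β j).2 (i.cast (by omega))
      have h3 : ratVec (v (i.cast (by omega))) ⬝ᵥ ratVec (w j) = 0 := by
        rw [hw, dotProduct_smul, h2, smul_zero]
      rw [dotProduct_comm, hdot] at h3
      exact_mod_cast h3
    exact h1
  · exact (hvF _).2

end LinearSketch

/-! ### Conditioning on the noise and the label, and the theorem. -/

namespace LinearSketch

/-- Comparing the laws of `(X, Y)` and `(G, Y)` one value of `Y` at a time. -/
lemma measure_le_of_slice_le {Ω α β ε : Type*} [MeasurableSpace Ω] [MeasurableSpace α]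
    [MeasurableSpace β] [MeasurableSpace ε] {ν : Measure Ω} {D : Measure α} {γ : Measure β}
    {I : Measure ε} [IsProbabilityMeasure D] [IsProbabilityMeasure γ] [IsProbabilityMeasure I]
    {X : Ω → α} {G : Ω → β} {Y : Ω → ε} (hX : Measurable X) (hG : Measurable G) (hY : Measurable Y)
    (hlaw : ν.map (fun ω => (X ω, G ω, Y ω)) = D.prod (γ.prod I)) {E : Set (β × ε)}
    {F : Set (α × ε)} (hE : MeasurableSet E) (hF : MeasurableSet F) {τ : ENNReal}
    (h : ∀ y, γ {x | (x, y) ∈ E} ≤ D {x | (x, y) ∈ F} + τ) :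
    ν {ω | (G ω, Y ω) ∈ E} ≤ ν {ω | (X ω, Y ω) ∈ F} + τ := by
  have hT : Measurable fun ω => (X ω, G ω, Y ω) := hX.prodMk (hG.prodMk hY)
  have h1 : ν.map (fun ω => (G ω, Y ω)) = γ.prod I := by
    have := congrArg (Measure.map Prod.snd) hlaw
    rw [Measure.map_map measurable_snd hT, Measure.map_snd_prod, measure_univ, one_smul] at this
    exact this
  have h2 : ν.map (fun ω => (X ω, Y ω)) = D.prod I := by
    have h3 := congrArg (Measure.map (Prod.map id Prod.snd)) hlaw
    rw [Measure.map_map (measurable_id.prodMap measurable_snd) hT,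
      ← Measure.map_prod_map _ _ measurable_id measurable_snd, Measure.map_id,
      Measure.map_snd_prod, measure_univ, one_smul] at h3
    exact h3
  calc ν {ω | (G ω, Y ω) ∈ E} = ν.map (fun ω => (G ω, Y ω)) E :=
        (Measure.map_apply (hG.prodMk hY) hE).symm
    _ = ∫⁻ y, γ {x | (x, y) ∈ E} ∂I := by rw [h1, Measure.prod_apply_symm hE]; rfl
    _ ≤ ∫⁻ y, (D {x | (x, y) ∈ F} + τ) ∂I := lintegral_mono h
    _ = ∫⁻ y, D {x | (x, y) ∈ F} ∂I + τ := by
        rw [lintegral_add_right _ measurable_const, lintegral_const, measure_univ, mul_one]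
    _ = ν.map (fun ω => (X ω, Y ω)) F + τ := by rw [h2, Measure.prod_apply_symm hF]; rfl
    _ = _ := by rw [Measure.map_apply (hX.prodMk hY) hF]; rfl

/-- The law of total probability, for an event depending on the label. -/
lemma measureReal_eq_sum_cond {Ω M : Type*} [MeasurableSpace Ω] [Fintype M] [MeasurableSpace M]
    [DiscreteMeasurableSpace M] {P : Measure Ω} [IsProbabilityMeasure P] {B : Ω → M}
    (hB : Measurable B) {E : M → Set Ω} (hE : ∀ b, MeasurableSet (E b)) :
    P.real {ω | ω ∈ E (B ω)} =
      ∑ b, P.real (B ⁻¹' {b}) * (P[|B ⁻¹' {b}]).real (E b) := by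
  have hm : ∀ b, MeasurableSet (B ⁻¹' {b}) := fun b => hB (MeasurableSet.of_discrete)
  have h1 : {ω | ω ∈ E (B ω)} = ⋃ b ∈ (Finset.univ : Finset M), B ⁻¹' {b} ∩ E b := by
    ext ω; simp
  have h2 : P {ω | ω ∈ E (B ω)} = ∑ b, P (B ⁻¹' {b} ∩ E b) := by
    rw [h1, measure_biUnion_finset _ fun b _ => (hm b).inter (hE b)]
    intro b _ b' _ hbb
    refine Set.disjoint_left.2 fun ω hω hω' => hbb ?_
    exact hω.1.symm.trans hω'.1
  rw [Measure.real, h2, ENNReal.toReal_sum fun b _ => measure_ne_top _ _]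
  refine Finset.sum_congr rfl fun b _ => ?_
  rw [← cond_mul_eq_inter (hm b) (E b) P, ENNReal.toReal_mul, mul_comm]
  rfl

end LinearSketch

theorem mainTheorem11 :
    ∃ Q₀ : ℝ, ∀ (n r : ℕ) (δ Q : ℝ) (A₀ : Matrix (Fin r) (Fin n) ℤ),
      0 < δ → δ < 1 / 10 → 2 ≤ Q → Q₀ ≤ Q → 4 * r ≤ n →
      (∀ i j, |(A₀ i j : ℝ)| ≤ Q) → (2 * n / δ) ^ 30 ≤ Q →
      -- the preprocessing can be carried out
      (∃ (l : ℕ) (At : Matrix (Fin l) (Fin n) ℤ), LinearSketch.IsPreprocessed Q A₀ At) ∧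
      -- and the lifting holds for every result of it
      ∀ (l : ℕ) (At : Matrix (Fin l) (Fin n) ℤ) (A : Matrix (Fin l) (Fin n) ℝ),
        LinearSketch.IsPreprocessed Q A₀ At →
        LinearSketch.RowOrthonormal A →
        LinearSketch.rowSpan A = LinearSketch.rowSpan (LinearSketch.toReal At) →
        -- the two usual normalizations of the Gaussian weight `exp (-κ xᵀ Σ⁻¹ x)`
        ∀ κ : ℝ, κ = 1 / 2 ∨ κ = Real.pi →
        ∀ (M : Type*) [Finite M] [MeasurableSpace M] [DiscreteMeasurableSpace M]
          (S : M → Matrix (Fin n) (Fin n) ℝ)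
          (I : M → Measure (Fin n → ℤ)) [∀ b, IsProbabilityMeasure (I b)]
          (Ω : Type*) [MeasurableSpace Ω] (P : Measure Ω) [IsProbabilityMeasure P]
          (B : Ω → M) (X Y : Ω → Fin n → ℤ) (G : Ω → EuclideanSpace ℝ (Fin n)),
          Measurable B → Measurable X → Measurable Y → Measurable G →
          (∀ b, ((S b)ᵀ * S b).det ≠ 0) →
          (∀ b, LinearSketch.singularValue (S b) 0 ≤ Q ^ (6 / 5 : ℝ)) →
          (∀ b, n * Q * Real.log Q ≤ LinearSketch.singularValue (S b) (n - 1)) →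
          -- given `B = b`, the variables `X`, `G`, `Y` are independent with the prescribed laws
          (∀ b, P (B ⁻¹' {b}) ≠ 0 →
            (P[|B ⁻¹' {b}]).map (fun ω => (X ω, G ω, Y ω)) =
              (LinearSketch.discreteGaussian κ ((S b)ᵀ * S b)).prod
                ((LinearSketch.continuousGaussian κ ((S b)ᵀ * S b)).prod (I b))) →
          ∀ (f : EuclideanSpace ℝ (Fin n) → Option M) (g : (Fin l → ℤ) → Option M),
            (∀ b, P (B ⁻¹' {b}) ≠ 0 →
              1 - δ / 3 ≤ (P[|B ⁻¹' {b}]).real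
                {ω | g (At *ᵥ (X ω + Y ω)) = f (LinearSketch.intVec (X ω + Y ω))}) →
            ∃ h : EuclideanSpace ℝ (Fin l) → M, Measurable h ∧
              -- the guarantee given each label
              (∀ b, P (B ⁻¹' {b}) ≠ 0 →
                1 - δ / 3 ≤ (P[|B ⁻¹' {b}]).real
                  {ω | f (LinearSketch.intVec (X ω + Y ω)) = some b} →
                1 - δ ≤ (P[|B ⁻¹' {b}]).real
                  {ω | h (LinearSketch.sketch A (G ω + LinearSketch.intVec (Y ω))) = b}) ∧
              -- the guarantee on average over the label
              (1 - δ / 3 ≤ P.real {ω | f (LinearSketch.intVec (X ω + Y ω)) = some (B ω)} →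
                1 - δ ≤ P.real
                  {ω | h (LinearSketch.sketch A (G ω + LinearSketch.intVec (Y ω))) = B ω}) := by
  -- No further lower bound on `Q` is needed: for `n ≥ 1` the bound by `(2n/δ)³⁰` is already large,
  -- and `n = 0` is trivial.
  refine ⟨0, ?_⟩
  intro n r δ Q A₀ hδ0 hδ hQ2 _ hrn hA₀ hQ
  have hnQ : (n : ℝ) ≤ Q := by
    rcases Nat.eq_zero_or_pos n with rfl | hn
    · simpa using by linarith
    · have hn1 : (1 : ℝ) ≤ n := by exact_mod_cast hn
      have ht : (n : ℝ) ≤ 2 * n / δ := by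
        rw [le_div_iff₀ hδ0]; nlinarith
      exact ht.trans ((le_self_pow₀ (hn1.trans ht) (by norm_num)).trans hQ)
  refine ⟨LinearSketch.exists_isPreprocessed (by linarith) hnQ hrn hA₀, ?_⟩
  intro l At A hpre hA hspan κ hκ M _ _ _ S I _ Ω _ P _ B X Y G hB hX hY hG hdet _ hσ hlaw f g hfg
  obtain ⟨v, hv, hv0⟩ := hpre.minima_le
  obtain ⟨ζ, hζ, hζd, hζA⟩ := LinearSketch.exists_measurable_rounding hA hspan
  have hζAt : ∀ z w, At *ᵥ ζ (LinearSketch.sketch A (LinearSketch.intVec z) + w) =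
      At *ᵥ (z + ζ w) := fun z w => (LinearSketch.sketch_intVec_eq_iff hspan).1 (hζA z w)
  have hft := Fintype.ofFinite M
  -- A sample point supplies the default label `B ω₀` for `h`.
  obtain ⟨ω₀⟩ := nonempty_of_isProbabilityMeasure P
  have hgm : Measurable fun w => (g (At *ᵥ ζ w)).getD (B ω₀) :=
    (measurable_of_countable fun z => (g (At *ᵥ z)).getD (B ω₀)).comp hζ
  have hfm : ∀ b, MeasurableSet {ω | f (LinearSketch.intVec (X ω + Y ω)) = some b} := fun b =>
    (hX.add hY) (MeasurableSet.of_discrete (s := {z | f (LinearSketch.intVec z) = some b}))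
  have hgfm : MeasurableSet {ω | g (At *ᵥ (X ω + Y ω)) = f (LinearSketch.intVec (X ω + Y ω))} :=
    (hX.add hY) (MeasurableSet.of_discrete (s := {z | g (At *ᵥ z) = f (LinearSketch.intVec z)}))
  have hskm : Measurable fun ω => LinearSketch.sketch A (G ω + LinearSketch.intVec (Y ω)) :=
    (LinearSketch.measurable_sketch A).comp (hG.add (LinearSketch.measurable_intVec.comp hY))
  have hhm : ∀ b, MeasurableSet {ω | (g (At *ᵥ ζ (LinearSketch.sketch A
      (G ω + LinearSketch.intVec (Y ω))))).getD (B ω₀) = b} := fun b =>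
    (hgm.comp hskm) (MeasurableSet.of_discrete (s := {b}))
  have key : ∀ b, P (B ⁻¹' {b}) ≠ 0 →
      (P[|B ⁻¹' {b}]).real {ω | f (LinearSketch.intVec (X ω + Y ω)) = some b} - 2 * δ / 3 ≤
      (P[|B ⁻¹' {b}]).real {ω | (g (At *ᵥ ζ (LinearSketch.sketch A
        (G ω + LinearSketch.intVec (Y ω))))).getD (B ω₀) = b} := by
    intro b hb
    have hν := cond_isProbabilityMeasure (μ := P) hb
    set ν := P[|B ⁻¹' {b}] with hνdef
    have hlawb := hlaw b hb
    have hγ : IsProbabilityMeasure (LinearSketch.continuousGaussian κ ((S b)ᵀ * S b)) := by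
      unfold LinearSketch.continuousGaussian; infer_instance
    -- The prescribed joint law has total mass one, and so do its other two factors; this forces the
    -- discrete Gaussian to be normalized.
    have hD : IsProbabilityMeasure (LinearSketch.discreteGaussian κ ((S b)ᵀ * S b)) := by
      have h1 := congrArg (fun μ => μ Set.univ) hlawb
      rw [Measure.map_apply (hX.prodMk (hG.prodMk hY)) MeasurableSet.univ, Set.preimage_univ,
        measure_univ, ← Set.univ_prod_univ, Measure.prod_prod,
        measure_univ (μ := (LinearSketch.continuousGaussian κ ((S b)ᵀ * S b)).prod (I b)),
        mul_one] at h1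
      exact ⟨h1.symm⟩
    have hcmp := LinearSketch.measure_le_of_slice_le (τ := ENNReal.ofReal (δ / 3)) hX hG hY hlawb
      (E := {p | g (At *ᵥ ζ (LinearSketch.sketch A (p.1 + LinearSketch.intVec p.2))) ≠ some b})
      (F := {p | g (At *ᵥ (p.1 + p.2)) ≠ some b})
      ((hζ.comp ((LinearSketch.measurable_sketch A).comp
        (measurable_fst.add (LinearSketch.measurable_intVec.comp measurable_snd))))
        (MeasurableSet.of_discrete (s := {z | g (At *ᵥ z) ≠ some b})))
      MeasurableSet.of_discrete (fun y => by
        have h1 := LinearSketch.continuousGaussian_rounding_le hδ0 hδ hQ hκ (hdet b) (hσ b) hA hspan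
          hv (fun i => (hv0 i).1) (fun i => (hv0 i).2) hζ hζd hζAt
          {u | g (At *ᵥ y + u) ≠ some b}
        simp only [Set.mem_ofPred_eq] at h1 ⊢
        -- Equivariance takes the fixed noise `y` out of the rounding as the translation `At *ᵥ y`,
        -- absorbed in the set of bad sketch values.
        simp_rw [LinearSketch.sketch_add, add_comm _ (LinearSketch.sketch A (LinearSketch.intVec y)),
          hζAt, Matrix.mulVec_add, add_comm _ (At *ᵥ y)]
        exact h1)
    have hreal : ν.real {ω | g (At *ᵥ ζ (LinearSketch.sketch A
        (G ω + LinearSketch.intVec (Y ω)))) ≠ some b} ≤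
        ν.real {ω | g (At *ᵥ (X ω + Y ω)) ≠ some b} + δ / 3 := by
      have h1 := ENNReal.toReal_mono (by finiteness) hcmp
      rw [ENNReal.toReal_add (by finiteness) (by finiteness),
        ENNReal.toReal_ofReal (by positivity)] at h1
      exact h1
    -- The default value can only help: `h` is correct whenever `g` returns `some b`.
    have hsub1 : ν.real {ω | (g (At *ᵥ ζ (LinearSketch.sketch A
        (G ω + LinearSketch.intVec (Y ω))))).getD (B ω₀) = b}ᶜ ≤
        ν.real {ω | g (At *ᵥ ζ (LinearSketch.sketch A
          (G ω + LinearSketch.intVec (Y ω)))) ≠ some b} := by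
      refine measureReal_mono fun ω hω h => hω ?_
      simp [h]
    have hsub2 : ν.real {ω | g (At *ᵥ (X ω + Y ω)) ≠ some b} ≤
        ν.real {ω | f (LinearSketch.intVec (X ω + Y ω)) = some b}ᶜ +
        ν.real {ω | g (At *ᵥ (X ω + Y ω)) = f (LinearSketch.intVec (X ω + Y ω))}ᶜ := by
      refine (measureReal_mono fun ω hω => ?_).trans (measureReal_union_le _ _)
      by_contra hcon
      rw [Set.mem_union, not_or, Set.notMem_compl_iff, Set.notMem_compl_iff] at hcon
      exact hω (hcon.2.trans hcon.1)
    have h3 := hfg b hb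
    rw [probReal_compl_eq_one_sub (hhm b)] at hsub1
    rw [probReal_compl_eq_one_sub (hfm b), probReal_compl_eq_one_sub hgfm] at hsub2
    linarith
  refine ⟨fun w => (g (At *ᵥ ζ w)).getD (B ω₀), hgm, fun b hb hfb => ?_, fun hf => ?_⟩
  · have := key b hb
    linarith
  · have e1 := LinearSketch.measureReal_eq_sum_cond (P := P) hB hfm
    have e2 := LinearSketch.measureReal_eq_sum_cond (P := P) hB hhm
    have e3 : ∑ b, P.real (B ⁻¹' {b}) = 1 := by
      have := LinearSketch.measureReal_eq_sum_cond (P := P) hB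
        (E := fun _ => Set.univ) fun _ => MeasurableSet.univ
      simp only [Set.mem_univ, Set.ofPred_true, probReal_univ] at this
      rw [this]
      refine Finset.sum_congr rfl fun b _ => ?_
      by_cases hb : P (B ⁻¹' {b}) = 0
      · simp [Measure.real, hb]
      · have := cond_isProbabilityMeasure (μ := P) hb
        rw [probReal_univ, mul_one]
    -- The loss `2δ/3` in `key` is the same for every label, so it survives averaging over `B`;
    -- labels of probability zero contribute nothing.
    have hle : ∑ b, P.real (B ⁻¹' {b}) *
        ((P[|B ⁻¹' {b}]).real {ω | f (LinearSketch.intVec (X ω + Y ω)) = some b} - 2 * δ / 3) ≤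
        ∑ b, P.real (B ⁻¹' {b}) * (P[|B ⁻¹' {b}]).real {ω | (g (At *ᵥ ζ (LinearSketch.sketch A
          (G ω + LinearSketch.intVec (Y ω))))).getD (B ω₀) = b} := by
      refine Finset.sum_le_sum fun b _ => ?_
      by_cases hb : P (B ⁻¹' {b}) = 0
      · simp [Measure.real, hb]
      · exact mul_le_mul_of_nonneg_left (key b hb) measureReal_nonneg
    simp_rw [mul_sub] at hle
    rw [Finset.sum_sub_distrib, ← Finset.sum_mul, e3, one_mul, ← e1, ← e2] at hle
    simp only [Set.mem_ofPred_eq] at hle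
    linarith
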